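/- Let $T>0$, $D=(0,1)$, $p\in\{2,3\}$, $\lambda_k=k\pi$ and $\varepsilon_k(x)=\sqrt2\,\sin(\lambda_k x)$ for $k\ge 1$; write $(\cdot,\cdot)$ and $\|\cdot\|$ for the inner product and norm of $L^2(D)$, and $\mathcal B(v_1,v_2)=(\partial_x^2v_1,\partial_x^2v_2)$ for $v_1,v_2\in H^2(D)$. Then there is a constant $C>0$ (depending only on $p$ and $T$; in particular independent of $\mathsf M_\star$, $\Delta t$, $h$ and $\Delta\tau$) such that the following holds. Let $W$ be a space-time white noise on $[0,T]\times D$ over a probability space $(\Omega,\mathcal F,P)$. Let $\mathsf M_\star,\mathsf N_\star,M\ge 1$ be integers, $\Delta t=T/\mathsf N_\star$, $T_n=((n-1)\Delta t,n\Delta t)$, and $$\widehat W(t,x)=\frac1{\Delta t}\sum_{i=1}^{\mathsf M_\star}\mathsf R^n_i\,\varepsilon_i(x)\quad (t\in T_n,\ 1\le n\le \mathsf N_\star),\qquad \mathsf R_i^n=\int_{T_n}\!\int_D\varepsilon_i(x)\,dW(t,x).$$ Let $\widehat u$ be the solution of $$\widehat u_t+\widehat u_{xxxx}=\widehat W\ \text{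 in }(0,T]\times D,\qquad \widehat u=\widehat u_{xx}=0\ \text{ on }\partial D,\qquad \widehat u(0,\cdot)=0,$$ almost surely, that is, $\widehat u\in C([0,T];L^2(D))\cap L^2(0,T;H^2(D)\cap H^1_0(D))$, $\widehat u(0,\cdot)=0$ and $(\widehat u(t,\cdot),\chi)+\int_0^t\mathcal B(\widehat u(s,\cdot),\chi)\,ds=\int_0^t(\widehat W(s,\cdot),\chi)\,ds$ for all $t\in[0,T]$ and $\chi\in H^2(D)\cap H_0^1(D)$. Let $\mathsf S_h^p\subset H^2(D)\cap H^1_0(D)$ be the finite element space of all functions in $H^2(D)\cap H^1_0(D)$ that are polynomials of degree at most $p$ on each interval of a given partition of $D$ with maximum mesh-length $h$. Let $\Delta\tau=T/M$, $\tau_m=m\,\Delta\tau$, and let $(U_h^m)_{m=0}^M\subset\mathsf S_h^p$ be the Crank–Nicolson finite element approximations, i.e. almost surely $U_h^0=0$ and, for $m=1,\dots,M$, $$(U_h^m-U_h^{m-1},\chi)+\tfrac{\Delta\tau}2\,\mathcal B(U_h^m+U_h^{m-1},\chi)=\int_{\tau_{m-1}}^{\tau_m}(\widehat W(s,\cdot),\chi)\,ds\qquad\forall\,\chi\in\mathsf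 S_h^p.$$ Then $\mathbb E\big[\|U_h^m-\widehat u(\tau_m,\cdot)\|^2\big]<\infty$ for $0\le m\le M$, and $$\max_{0\le m\le M}\Big(\mathbb E\big[\|U_h^m-\widehat u(\tau_m,\cdot)\|^2\big]\Big)^{1/2}\le C\Big(\epsilon_1^{-1/2}\,h^{\frac p2-\epsilon_1}+\epsilon_2^{-1/2}\,\Delta\tau^{\frac38-\epsilon_2}\Big)\qquad\forall\,\epsilon_1\in(0,\tfrac p2],\ \forall\,\epsilon_2\in(0,\tfrac38].$$ -/

import Mathlib

open MeasureTheory ProbabilityTheory Set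
open scoped InnerProductSpace

namespace CrankNicolson

noncomputable section

/-! ### The spaces `L²(D)`, `H¹(D)`, `H²(D) ∩ H¹₀(D)` for `D = (0,1)` -/

/-- Lebesgue measure on `D = (0,1)`. -/
abbrev measD : Measure ℝ := volume.restrict (Ioo (0 : ℝ) 1)

/-- The Hilbert space `L²(D)`. -/
abbrev L2D : Type := Lp ℝ 2 measD

/-- `g ∈ L²(D)` is the generalized derivative of `f ∈ L²(D)`:
`∫_D f φ' = - ∫_D g φ` for all `φ ∈ C_c^∞(D)`. -/
def HasWeakDeriv (f g : L2D) : Prop :=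
  ∀ φ : ℝ → ℝ, ContDiff ℝ (⊤ : ℕ∞) φ → HasCompactSupport φ → tsupport φ ⊆ Ioo 0 1 →
    ∫ x, f x * deriv φ x ∂measD = - ∫ x, g x * φ x ∂measD

open Classical in
/-- The generalized derivative of `f` if it exists in `L²(D)` (it is then unique), else `0`. -/
def weakDeriv (f : L2D) : L2D :=
  if h : ∃ g, HasWeakDeriv f g then h.choose else 0

/-- `f ∈ H¹(D)`. -/
def MemH1 (f : L2D) : Prop := ∃ g, HasWeakDeriv f g

/-- `f ∈ H²(D)`. -/
def MemH2 (f : L2D) : Prop := ∃ g₁ g₂, HasWeakDeriv f g₁ ∧ HasWeakDeriv g₁ g₂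

/-- `f ∈ H¹₀(D)`: `f ∈ H¹(D)` and the continuous representative of `f` on `[0,1]` vanishes at the
endpoints. -/
def MemH10 (f : L2D) : Prop :=
  MemH1 f ∧ ∃ c : ℝ → ℝ, ContinuousOn c (Icc 0 1) ∧ f =ᵐ[measD] c ∧ c 0 = 0 ∧ c 1 = 0

/-- The space `H²(D) ∩ H¹₀(D)`. -/
def H2H10 : Set L2D := {f | MemH2 f ∧ MemH10 f}

/-- The bilinear form `𝓑(v₁, v₂) = (∂ₓ² v₁, ∂ₓ² v₂)`. -/
def bform (v₁ v₂ : L2D) : ℝ := ⟪weakDeriv (weakDeriv v₁), weakDeriv (weakDeriv v₂)⟫_ℝ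

/-! ### The noise -/

/-- `ε_k(x) = √2 sin(kπx)`. -/
def eps (k : ℕ) (x : ℝ) : ℝ := √2 * Real.sin (k * Real.pi * x)

theorem memLp_eps (k : ℕ) : MemLp (eps k) 2 measD := by
  refine MemLp.of_bound (by unfold eps; fun_prop) (√2) (Filter.Eventually.of_forall fun x => ?_)
  rw [eps, norm_mul, Real.norm_of_nonneg (Real.sqrt_nonneg 2)]
  exact mul_le_of_le_one_right (Real.sqrt_nonneg 2) (Real.abs_sin_le_one _)

/-- `ε_k` as an element of `L²(D)`. -/
def epsL2 (k : ℕ) : L2D := (memLp_eps k).toLp (eps k)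

/-- Lebesgue measure on `(0,T) × D`. -/
abbrev measTD (T : ℝ) : Measure (ℝ × ℝ) := volume.restrict (Ioo (0 : ℝ) T ×ˢ Ioo (0 : ℝ) 1)

/-- `W` is a space-time white noise on `[0,T] × D`, given by its Wiener integrals
`W(g) = ∫_0^T ∫_D g dW` of deterministic `g ∈ L²((0,T) × D)`: a centred Gaussian process indexed by
`L²((0,T) × D)` with covariance `E[W(f) W(g)] = (f, g)`. -/
structure IsWhiteNoise (T : ℝ) {Ω : Type*} [MeasurableSpace Ω] (P : Measure Ω)
    (W : Lp ℝ 2 (measTD T) → Ω → ℝ) : Prop where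
  gaussian : IsGaussianProcess W P
  centred : ∀ f, ∫ ω, W f ω ∂P = 0
  covar : ∀ f g, ∫ ω, W f ω * W g ω ∂P = ⟪f, g⟫_ℝ

/-- The open time interval `((n-1) δ, n δ)`. -/
def timeInterval (δ : ℝ) (n : ℕ) : Set ℝ := Ioo (((n : ℝ) - 1) * δ) (n * δ)

/-- The function `(t, x) ↦ 1_{((n-1)δ, nδ)}(t) ε_i(x)`. -/
def cell (δ : ℝ) (n i : ℕ) (z : ℝ × ℝ) : ℝ := (timeInterval δ n).indicator 1 z.1 * eps i z.2

theorem memLp_cell (T δ : ℝ) (n i : ℕ) : MemLp (cell δ n i) 2 (measTD T) := by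
  have : IsFiniteMeasure (measTD T) := by
    refine ⟨?_⟩
    rw [Measure.restrict_apply_univ, Measure.volume_eq_prod, Measure.prod_prod]
    simp
  have h1 : Measurable fun z : ℝ × ℝ => (timeInterval δ n).indicator (1 : ℝ → ℝ) z.1 :=
    (measurable_one.indicator measurableSet_Ioo).comp measurable_fst
  have h2 : Measurable fun z : ℝ × ℝ => eps i z.2 := by unfold eps; fun_prop
  refine MemLp.of_bound (h1.mul h2).aestronglyMeasurable (√2)
    (Filter.Eventually.of_forall fun z => ?_)
  have h3 : ‖(timeInterval δ n).indicator (1 : ℝ → ℝ) z.1‖ ≤ 1 := by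
    by_cases h : z.1 ∈ timeInterval δ n <;> simp [h]
  have h4 : ‖eps i z.2‖ ≤ √2 := by
    rw [eps, norm_mul, Real.norm_of_nonneg (Real.sqrt_nonneg 2)]
    exact mul_le_of_le_one_right (Real.sqrt_nonneg 2) (Real.abs_sin_le_one _)
  rw [cell, norm_mul]
  exact (mul_le_mul h3 h4 (norm_nonneg _) zero_le_one).trans (one_mul _).le

/-- `R^n_i = ∫_{T_n} ∫_D ε_i(x) dW(t,x)`, where `T_n = ((n-1)Δt, nΔt)` and `Δt = T/N`. -/
def increment (T : ℝ) (N : ℕ) {Ω : Type*} (W : Lp ℝ 2 (measTD T) → Ω → ℝ) (n i : ℕ) (ω : Ω) : ℝ :=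
  W ((memLp_cell T (T / N) n i).toLp (cell (T / N) n i)) ω

/-- The spectral noise `Ŵ(s, ·) = (1/Δt) ∑_{i=1}^{K} R^n_i ε_i` for `s ∈ T_n`, `n = 1, …, N`
(and `0` at the nodes), as a path with values in `L²(D)`. -/
def spectralNoise (T : ℝ) (K N : ℕ) {Ω : Type*} (W : Lp ℝ 2 (measTD T) → Ω → ℝ) (ω : Ω) (s : ℝ) :
    L2D :=
  ∑ n ∈ Finset.Icc 1 N, (timeInterval (T / N) n).indicator
    (fun _ => (T / N)⁻¹ • ∑ i ∈ Finset.Icc 1 K, increment T N W n i ω • epsL2 i) s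

/-! ### The fourth order problem -/

/-- `u` is the (variational) solution on `[0,T]` of
`u_t + u_xxxx = f` in `(0,T] × D`, `u = u_xx = 0` on `∂D`, `u(0, ·) = 0`:
`u ∈ C([0,T]; L²(D)) ∩ L²(0,T; H²(D) ∩ H¹₀(D))`, `u(0) = 0` and, for all `χ ∈ H²(D) ∩ H¹₀(D)` and
`t ∈ [0,T]`, `(u(t), χ) + ∫_0^t 𝓑(u(s), χ) ds = ∫_0^t (f(s), χ) ds`. The condition `u_xx = 0`
on `∂D` is the natural boundary condition of this formulation. -/
structure IsSolution (T : ℝ) (f u : ℝ → L2D) : Prop where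
  continuousOn : ContinuousOn u (Icc 0 T)
  mem : ∀ᵐ t ∂volume.restrict (Ioo 0 T), u t ∈ H2H10
  memLp : MemLp (fun t => weakDeriv (weakDeriv (u t))) 2 (volume.restrict (Ioo 0 T))
  initial : u 0 = 0
  equation : ∀ t ∈ Icc 0 T, ∀ χ ∈ H2H10,
    ⟪u t, χ⟫_ℝ + ∫ s in (0 : ℝ)..t, bform (u s) χ = ∫ s in (0 : ℝ)..t, ⟪f s, χ⟫_ℝ

/-! ### Finite elements and the Crank–Nicolson method -/

/-- A partition `0 = x_0 < x_1 < ⋯ < x_J = 1` of `D`. -/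
structure Mesh where
  J : ℕ
  node : Fin (J + 1) → ℝ
  strictMono : StrictMono node
  node_zero : node 0 = 0
  node_last : node (Fin.last J) = 1

/-- The maximum mesh-length `h`. -/
def Mesh.size (X : Mesh) : ℝ := ⨆ j : Fin X.J, (X.node j.succ - X.node j.castSucc)

/-- The finite element space `S_h^p` of all functions in `H²(D) ∩ H¹₀(D)` that are polynomials of
degree at most `p` on every interval of the partition. -/
def feSpace (p : ℕ) (X : Mesh) : Set L2D :=
  {χ | χ ∈ H2H10 ∧ ∀ j : Fin X.J, ∃ q : Polynomial ℝ, q.natDegree ≤ p ∧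
    ∀ᵐ x ∂volume.restrict (Ioo (X.node j.castSucc) (X.node j.succ)), χ x = q.eval x}

/-- `(U^m)_{m=0}^M` are the Crank–Nicolson finite element approximations, with time step
`Δτ = T/M`, of the problem with load `f` and vanishing initial value. -/
structure IsCrankNicolsonFE (p : ℕ) (X : Mesh) (T : ℝ) (M : ℕ) (f : ℝ → L2D) (U : ℕ → L2D) :
    Prop where
  initial : U 0 = 0
  mem : ∀ m ∈ Finset.Icc 1 M, U m ∈ feSpace p X
  step : ∀ m ∈ Finset.Icc 1 M, ∀ χ ∈ feSpace p X,
    ⟪U m - U (m - 1), χ⟫_ℝ + (T / M) / 2 * bform (U m + U (m - 1)) χ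
      = ∫ s in timeInterval (T / M) m, ⟪f s, χ⟫_ℝ

end

end CrankNicolson

/-!
Let `G` be the inverse of `-∂ₓ²` with Dirichlet conditions, an integral operator on `L²(D)` with
kernel `g(x,y) = min(x,y) - xy`. Then `H²(D) ∩ H¹₀(D)` is the range of `G` (`mem_H2H10_iff`), and
`𝓑(Gv, Gw) = (v, w)`. In one dimension the finite element space is the image under `G` of all
piecewise polynomials of degree at most `p - 2`, without any continuity at the nodes
(`mem_feSpace_iff`). Hence the solution operator of the biharmonic problem is `A = G²`, and its
Galerkin approximation is `A_h = G Π G`, where `Π` is the orthogonal projection onto these piecewise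
polynomials. Both problems become evolution equations for bounded operators on `L²(D)`:
`A u(t) + ∫₀ᵗ u = A ∫₀ᵗ f` and `A_h (Uᵐ - Uᵐ⁻¹) + (Δτ/2)(Uᵐ + Uᵐ⁻¹) = A_h ∫ f`. They have unique
solutions, given by the continuous and the discrete Duhamel formula (`IsSolution.eq_duhamel`,
`IsCrankNicolsonFE.eq_sum`).

Therefore the error at time `τ_m` is the sum over `n` and `i` of the increment `R^n_i` times a fixed
vector, which is an average over `T_n` of a kernel `κ_i(s)` (`error_eq_sum`). The increments are
uncorrelated with variance `Δt`. So, after Bessel's inequality in time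
(`sum_norm_sq_integral_indicator_le`), the mean square error is at most `∑ᵢ ∫ ‖κ_i(s)‖² ds`, a bound
in which `Δt` does not appear. With `μ_i = (iπ)⁻⁴` the eigenvalue of `A` at `ε_i`, this is estimated
in two parts.

* Space. Testing the error equation with its midpoint values shows that replacing `A` by `A_h` in
  the Crank–Nicolson method costs at most `μ_i⁻¹ ‖(A_h - A) ε_i‖² = ‖G(1 - Π)ε_i‖²`
  (`IsSymmPos.sum_norm_sq_cnImpulse_sub_le`). By Bessel's inequality the sum over `i` is at most
  `∫ ‖(1 - Π) g(x, ·)‖² dx`. This is `O(h^p)`: for `p = 2` as `g(x, ·)` is Lipschitz, for `p = 3` as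
  moreover it is affine on all intervals of the partition but the one that contains `x`
  (`sum_norm_sq_greenOp_sub_polyProj_le`).
* Time. For the scalar equation `μ y' + y = 0` the squared error of the midpoint values is
  `O(μ min(1, (Δτ/μ)²))`, hence `O(μ (Δτ/μ)^a)` for `0 ≤ a ≤ 2`
  (`sum_integral_cnScalar_sub_exp_sq_le`). With `a = 3/4 - 2ε₂` the sum over the modes is
  `Δτ^a ∑ᵢ i^(-1-8ε₂) = O(Δτ^a / ε₂)`.
-/

namespace CrankNicolson

noncomputable section

/-! ### Test functions and weak derivatives on an interval -/

/-- `φ` is a test function on `(a, b)`: smooth, with compact support contained in `(a, b)`. -/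
structure IsTest (a b : ℝ) (φ : ℝ → ℝ) : Prop where
  smooth : ContDiff ℝ (⊤ : ℕ∞) φ
  compact : HasCompactSupport φ
  subset : tsupport φ ⊆ Ioo a b

namespace IsTest

variable {a b : ℝ} {φ ψ : ℝ → ℝ}

theorem differentiable (h : IsTest a b φ) : Differentiable ℝ φ :=
  (contDiff_infty_iff_deriv.mp h.smooth).1

theorem hasDerivAt (h : IsTest a b φ) (x : ℝ) : HasDerivAt φ (deriv φ x) x :=
  (h.differentiable x).hasDerivAt

theorem deriv (h : IsTest a b φ) : IsTest a b (deriv φ) :=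
  ⟨(contDiff_infty_iff_deriv.mp h.smooth).2, h.compact.deriv,
    (tsupport_deriv_subset (f := φ)).trans h.subset⟩

theorem continuous (h : IsTest a b φ) : Continuous φ := h.smooth.continuous

theorem integrable (h : IsTest a b φ) : Integrable φ :=
  h.continuous.integrable_of_hasCompactSupport h.compact

theorem eq_zero_of_notMem (h : IsTest a b φ) {x : ℝ} (hx : x ∉ Ioo a b) : φ x = 0 :=
  image_eq_zero_of_notMem_tsupport fun hx' => hx (h.subset hx')

theorem mono {c d : ℝ} (h : IsTest a b φ) (hsub : Ioo a b ⊆ Ioo c d) : IsTest c d φ :=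
  ⟨h.smooth, h.compact, h.subset.trans hsub⟩

theorem bounded (h : IsTest a b φ) : ∃ B, 0 ≤ B ∧ ∀ x, |φ x| ≤ B := by
  obtain ⟨B, hB⟩ := h.compact.exists_bound_of_continuous h.continuous
  exact ⟨B, (norm_nonneg _).trans (hB 0), hB⟩

theorem sub_smul (hφ : IsTest a b φ) (hψ : IsTest a b ψ) (c : ℝ) :
    IsTest a b fun x => φ x - c * ψ x := by
  refine ⟨hφ.smooth.sub (contDiff_const.mul hψ.smooth), ?_, ?_⟩
  · exact hφ.compact.sub (hψ.compact.mul_left (f := fun _ => c))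
  · refine (tsupport_sub φ (fun x => c * ψ x)).trans (union_subset hφ.subset ?_)
    exact (tsupport_mul_subset_right (f := fun _ => c) (g := ψ)).trans hψ.subset

/-- Integrals against a test function on a subinterval may be taken over the subinterval. -/
theorem setIntegral_mul {c d : ℝ} (h : IsTest a b φ) (hsub : Ioo a b ⊆ Ioo c d) (f : ℝ → ℝ) :
    ∫ x in Ioo c d, f x * φ x = ∫ x in Ioo a b, f x * φ x := by
  refine setIntegral_eq_of_subset_of_forall_sdiff_eq_zero measurableSet_Ioo hsub fun x hx => ?_
  rw [h.eq_zero_of_notMem hx.2, mul_zero]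

/-- A test function of vanishing integral is the derivative of a test function. -/
theorem exists_primitive (hab : a < b) (h : IsTest a b φ) (h0 : ∫ x, φ x = 0) :
    ∃ Φ, IsTest a b Φ ∧ _root_.deriv Φ = φ := by
  obtain ⟨c, d, hac, hdb, hcd⟩ : ∃ c d, a < c ∧ d < b ∧ tsupport φ ⊆ Icc c d := by
    rcases (tsupport φ).eq_empty_or_nonempty with he | hne
    · exact ⟨(a + b) / 2, (a + b) / 2, by linarith, by linarith, by simp [he]⟩
    · refine ⟨sInf (tsupport φ), sSup (tsupport φ), (h.subset (h.compact.sInf_mem hne)).1,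
        (h.subset (h.compact.sSup_mem hne)).2, fun x hx => ⟨?_, ?_⟩⟩
      · exact csInf_le h.compact.bddBelow hx
      · exact le_csSup h.compact.bddAbove hx
  have hz : ∀ x, x ∉ Icc c d → φ x = 0 := fun x hx =>
    image_eq_zero_of_notMem_tsupport fun hx' => hx (hcd hx')
  have hd : ∀ x, HasDerivAt (fun x => ∫ t in a..x, φ t) (φ x) x := fun x =>
    intervalIntegral.integral_hasDerivAt_right (h.continuous.intervalIntegrable _ _)
      (h.continuous.stronglyMeasurableAtFilter _ _) h.continuous.continuousAt
  have hderiv : _root_.deriv (fun x => ∫ t in a..x, φ t) = φ := funext fun x => (hd x).deriv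
  have hsupp : ∀ x, x ∉ Icc c d → ∫ t in a..x, φ t = 0 := by
    intro x hx
    rw [mem_Icc, not_and_or, not_le, not_le] at hx
    rcases hx with hx | hx
    · refine intervalIntegral.integral_zero_ae (Filter.Eventually.of_forall fun t ht => hz t ?_)
      rw [uIoc, mem_Ioc] at ht
      have : max a x < c := max_lt hac hx
      exact fun h' => by linarith [h'.1, ht.2]
    · by_cases hax : a ≤ x
      · rw [intervalIntegral.integral_of_le hax, ← h0]
        refine setIntegral_eq_integral_of_forall_compl_eq_zero fun t ht => hz t fun h' => ht ?_
        exact ⟨hac.trans_le h'.1, h'.2.trans hx.le⟩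
      · refine intervalIntegral.integral_zero_ae (Filter.Eventually.of_forall fun t ht => hz t ?_)
        rw [uIoc_of_ge (not_le.mp hax).le, mem_Ioc] at ht
        exact fun h' => by linarith [h'.1, ht.2]
  have hts : tsupport (fun x => ∫ t in a..x, φ t) ⊆ Icc c d :=
    closure_minimal (fun x hx => by_contra fun h' => hx (hsupp x h')) isClosed_Icc
  refine ⟨_, ⟨?_, ?_, hts.trans fun x hx => ⟨hac.trans_le hx.1, hx.2.trans_lt hdb⟩⟩, hderiv⟩
  · exact contDiff_infty_iff_deriv.mpr
      ⟨fun x => (hd x).differentiableAt, by rw [hderiv]; exact h.smooth⟩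
  · exact isCompact_Icc.of_isClosed_subset (isClosed_tsupport _) hts

theorem exists_integral_pos (hab : a < b) : ∃ ψ, IsTest a b ψ ∧ 0 < ∫ x, ψ x := by
  obtain ⟨ψ, h1, h2, h3, h4, h5⟩ := exists_contDiff_tsupport_subset (n := ⊤)
    (Ioo_mem_nhds (show a < (a + b) / 2 by linarith) (show (a + b) / 2 < b by linarith))
  refine ⟨ψ, ⟨h3, h2, h1⟩, h3.continuous.integral_pos_of_hasCompactSupport_nonneg_nonzero h2
    (fun x => (h4 ⟨x, rfl⟩).1) (x := (a + b) / 2) (by rw [h5]; exact one_ne_zero)⟩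

end IsTest

section Interval

variable {a b : ℝ}

/-- The fundamental lemma of the calculus of variations on `(a, b)`. -/
theorem ae_eq_zero_of_forall_isTest {f : ℝ → ℝ} (hf : IntegrableOn f (Ioo a b))
    (h : ∀ φ, IsTest a b φ → ∫ x in Ioo a b, f x * φ x = 0) :
    ∀ᵐ x ∂volume.restrict (Ioo a b), f x = 0 := by
  rw [ae_restrict_iff' measurableSet_Ioo]
  refine isOpen_Ioo.ae_eq_zero_of_integral_contDiff_smul_eq_zero hf.locallyIntegrableOn
    fun φ h1 h2 h3 => ?_
  have ht : IsTest a b φ := ⟨h1, h2, h3⟩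
  rw [← h φ ht, ← setIntegral_eq_integral_of_forall_compl_eq_zero (s := Ioo a b)]
  · simp_rw [smul_eq_mul, mul_comm]
  · intro x hx
    rw [ht.eq_zero_of_notMem hx, zero_smul]

theorem integrableOn_mul_isTest {f φ : ℝ → ℝ} (hf : IntegrableOn f (Ioo a b))
    (hφ : IsTest a b φ) : IntegrableOn (fun x => f x * φ x) (Ioo a b) := by
  obtain ⟨B, -, hB⟩ := hφ.bounded
  exact Integrable.mul_bdd hf hφ.continuous.aestronglyMeasurable
    (Filter.Eventually.of_forall hB)

/-- Du Bois-Reymond's lemma: a function with vanishing weak derivative is constant. -/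
theorem ae_const_of_weakDeriv_zero (hab : a < b) {f : ℝ → ℝ} (hf : IntegrableOn f (Ioo a b))
    (h : ∀ φ, IsTest a b φ → ∫ x in Ioo a b, f x * deriv φ x = 0) :
    ∃ c, ∀ᵐ x ∂volume.restrict (Ioo a b), f x = c := by
  obtain ⟨ψ, hψ, hpos⟩ := IsTest.exists_integral_pos hab
  set c := (∫ x in Ioo a b, f x * ψ x) / ∫ x, ψ x with hc
  have hfull : ∀ {φ}, IsTest a b φ → ∫ x in Ioo a b, φ x = ∫ x, φ x := fun {φ} hφ =>
    setIntegral_eq_integral_of_forall_compl_eq_zero fun x hx => hφ.eq_zero_of_notMem hx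
  refine ⟨c, ?_⟩
  have key : ∀ᵐ x ∂volume.restrict (Ioo a b), f x - c = 0 := by
    refine ae_eq_zero_of_forall_isTest (hf.sub (integrableOn_const (by simp))) fun φ hφ => ?_
    -- subtracting a multiple of `ψ` makes the integral of `φ` vanish
    obtain ⟨Φ, hΦ, hd⟩ := (hφ.sub_smul hψ ((∫ x, φ x) / ∫ x, ψ x)).exists_primitive hab (by
      rw [integral_sub hφ.integrable (hψ.integrable.const_mul _), integral_const_mul,
        div_mul_cancel₀ _ hpos.ne', sub_self])
    have h1 := h Φ hΦ
    have i1 := integrableOn_mul_isTest hf hφ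
    have i2 := integrableOn_mul_isTest hf hψ
    simp_rw [hd, mul_sub, mul_left_comm (f _)] at h1
    rw [integral_sub i1 (i2.const_mul _), integral_const_mul] at h1
    simp_rw [sub_mul]
    rw [integral_sub i1 (hφ.integrable.integrableOn.const_mul _), integral_const_mul, hfull hφ,
      sub_eq_zero.mp h1, hc]
    ring
  filter_upwards [key] with x hx using sub_eq_zero.mp hx

theorem exists_derivative_eq (r : Polynomial ℝ) :
    ∃ q : Polynomial ℝ, Polynomial.derivative q = r ∧ q.natDegree ≤ r.natDegree + 1 := by
  refine ⟨∑ n ∈ Finset.range (r.natDegree + 1),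
    Polynomial.C (r.coeff n / (n + 1)) * Polynomial.X ^ (n + 1), ?_, ?_⟩
  · conv_rhs => rw [r.as_sum_range_C_mul_X_pow]
    rw [Polynomial.derivative_sum]
    refine Finset.sum_congr rfl fun n _ => ?_
    rw [Polynomial.derivative_C_mul_X_pow, Nat.add_sub_cancel]
    congr 2
    push_cast
    field_simp
  · refine Polynomial.natDegree_sum_le_of_forall_le _ _ fun n hn => ?_
    refine (Polynomial.natDegree_C_mul_X_pow_le _ _).trans ?_
    have := Finset.mem_range.mp hn
    lia

theorem setIntegral_polynomial_mul_deriv (q : Polynomial ℝ) {φ : ℝ → ℝ} (hφ : IsTest a b φ) :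
    ∫ x in Ioo a b, q.eval x * deriv φ x
      = - ∫ x in Ioo a b, (Polynomial.derivative q).eval x * φ x := by
  by_cases hab : a ≤ b
  · rw [← integral_Ioc_eq_integral_Ioo, ← integral_Ioc_eq_integral_Ioo,
      ← intervalIntegral.integral_of_le hab, ← intervalIntegral.integral_of_le hab,
      intervalIntegral.integral_mul_deriv_eq_deriv_mul (fun x _ => q.hasDerivAt x)
        (fun x _ => hφ.hasDerivAt x) (by apply Continuous.intervalIntegrable; fun_prop)
        (hφ.deriv.continuous.intervalIntegrable _ _),
      hφ.eq_zero_of_notMem (x := a) (by simp), hφ.eq_zero_of_notMem (x := b) (by simp)]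
    ring
  · simp [Ioo_eq_empty_of_le (not_le.mp hab).le]

/-- A function whose weak derivative on `(a, b)` is a polynomial is itself a polynomial. -/
theorem ae_polynomial_of_weakDeriv (hab : a < b) {f g : ℝ → ℝ} (hf : IntegrableOn f (Ioo a b))
    (h : ∀ φ, IsTest a b φ → ∫ x in Ioo a b, f x * deriv φ x = - ∫ x in Ioo a b, g x * φ x)
    {r : Polynomial ℝ} (hr : ∀ᵐ x ∂volume.restrict (Ioo a b), g x = r.eval x) :
    ∃ q : Polynomial ℝ, Polynomial.derivative q = r ∧ q.natDegree ≤ r.natDegree + 1 ∧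
      ∀ᵐ x ∂volume.restrict (Ioo a b), f x = q.eval x := by
  obtain ⟨q, hq, hdeg⟩ := exists_derivative_eq r
  have hqi : IntegrableOn (fun x => q.eval x) (Ioo a b) :=
    (q.continuous.integrableOn_Icc (a := a) (b := b)).mono_set Ioo_subset_Icc_self
  obtain ⟨c, hc⟩ := ae_const_of_weakDeriv_zero hab (hf.sub hqi) (f := fun x => f x - q.eval x)
    fun φ hφ => by
      simp_rw [sub_mul]
      rw [integral_sub (integrableOn_mul_isTest hf hφ.deriv)
        (integrableOn_mul_isTest hqi hφ.deriv), h φ hφ, setIntegral_polynomial_mul_deriv q hφ, hq,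
        integral_congr_ae (g := fun x => r.eval x * φ x), sub_self]
      filter_upwards [hr] with x hx
      rw [hx]
  refine ⟨q + Polynomial.C c, by simp [hq], ?_, ?_⟩
  · rwa [Polynomial.natDegree_add_C]
  · filter_upwards [hc] with x hx
    rw [Polynomial.eval_add, Polynomial.eval_C, ← hx]
    ring

end Interval

/-! ### Integral operators with bounded kernels on `L²(D)` -/

instance isProbabilityMeasure_measD : IsProbabilityMeasure measD := ⟨by simp⟩

theorem L2D.integrable (f : L2D) : Integrable f measD := (Lp.memLp f).integrable one_le_two

theorem L2D.inner_eq (f g : L2D) : ⟪f, g⟫_ℝ = ∫ x, f x * g x ∂measD := by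
  rw [L2.inner_def]
  refine integral_congr_ae (Filter.Eventually.of_forall fun x => ?_)
  simp only [RCLike.inner_apply, conj_trivial]
  ring

theorem L2D.norm_sq_eq (f : L2D) : ‖f‖ ^ 2 = ∫ x, f x ^ 2 ∂measD := by
  rw [← real_inner_self_eq_norm_sq, L2D.inner_eq]
  simp_rw [sq]

/-- A measurable kernel on `ℝ × D` that is bounded by `1`. -/
structure IsKernel (k : ℝ → ℝ → ℝ) : Prop where
  meas : Measurable (Function.uncurry k)
  bound : ∀ x, ∀ y ∈ Ioo (0 : ℝ) 1, |k x y| ≤ 1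

namespace IsKernel

variable {k : ℝ → ℝ → ℝ}

theorem ae_bound (hk : IsKernel k) (x : ℝ) : ∀ᵐ y ∂measD, ‖k x y‖ ≤ 1 := by
  filter_upwards [ae_restrict_mem measurableSet_Ioo] with y hy using hk.bound x y hy

theorem memLp (hk : IsKernel k) (x : ℝ) : MemLp (k x) 2 measD :=
  MemLp.of_bound (hk.meas.of_uncurry_left).aestronglyMeasurable 1 (hk.ae_bound x)

/-- The section `k(x, ·)` as an element of `L²(D)`. -/
def section_ (hk : IsKernel k) (x : ℝ) : L2D := (hk.memLp x).toLp (k x)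

theorem coeFn_section (hk : IsKernel k) (x : ℝ) : hk.section_ x =ᵐ[measD] k x :=
  (hk.memLp x).coeFn_toLp

theorem norm_section_le (hk : IsKernel k) (x : ℝ) : ‖hk.section_ x‖ ≤ 1 := by
  have h := Lp.norm_le_of_ae_bound (f := hk.section_ x) zero_le_one (by
    filter_upwards [hk.coeFn_section x, hk.ae_bound x] with y h1 h2
    rwa [h1])
  simpa [measureUnivNNReal] using h

theorem inner_section (hk : IsKernel k) (x : ℝ) (f : L2D) :
    ⟪hk.section_ x, f⟫_ℝ = ∫ y, k x y * f y ∂measD := by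
  rw [L2D.inner_eq]
  refine integral_congr_ae ?_
  filter_upwards [hk.coeFn_section x] with y hy
  rw [hy]

theorem integrable_prod (hk : IsKernel k) {f ψ : ℝ → ℝ} (hf : Integrable f measD)
    (hψ : Integrable ψ measD) :
    Integrable (fun z : ℝ × ℝ => k z.1 z.2 * (ψ z.1 * f z.2)) (measD.prod measD) := by
  refine (hψ.mul_prod hf).bdd_mul (c := 1) hk.meas.aestronglyMeasurable ?_
  have : ∀ᵐ z ∂(measD.prod measD), z.2 ∈ Ioo (0 : ℝ) 1 :=
    Measure.quasiMeasurePreserving_snd.ae (ae_restrict_mem measurableSet_Ioo)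
  filter_upwards [this] with z hz using hk.bound _ _ hz

theorem aestronglyMeasurable_integral (hk : IsKernel k) (f : L2D) :
    AEStronglyMeasurable (fun x => ∫ y, k x y * f y ∂measD) measD := by
  have h := (hk.integrable_prod (L2D.integrable f) (integrable_const (1 : ℝ))).integral_prod_left
  simp only [one_mul] at h
  exact h.aestronglyMeasurable

theorem abs_inner_section_le (hk : IsKernel k) (x : ℝ) (f : L2D) :
    |⟪hk.section_ x, f⟫_ℝ| ≤ ‖f‖ :=
  (abs_real_inner_le_norm _ _).trans
    (mul_le_of_le_one_left (norm_nonneg _) (hk.norm_section_le x))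

theorem memLp_integral (hk : IsKernel k) (f : L2D) :
    MemLp (fun x => ⟪hk.section_ x, f⟫_ℝ) 2 measD := by
  refine MemLp.of_bound ?_ ‖f‖ (Filter.Eventually.of_forall fun x => hk.abs_inner_section_le x f)
  simp_rw [inner_section]
  exact hk.aestronglyMeasurable_integral f

/-- The integral operator `(Kf)(x) = ∫_D k(x,y) f(y) dy` on `L²(D)`. -/
def op (hk : IsKernel k) : L2D →L[ℝ] L2D :=
  LinearMap.mkContinuous
    { toFun := fun f => (hk.memLp_integral f).toLp _
      map_add' := fun f g => by
        rw [← MemLp.toLp_add]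
        congr 1
        funext x
        exact inner_add_right _ _ _
      map_smul' := fun c f => by
        rw [RingHom.id_apply, ← MemLp.toLp_const_smul]
        congr 1
        funext x
        exact real_inner_smul_right _ _ _ } 1 fun f => by
    have h := Lp.norm_le_of_ae_bound (f := (hk.memLp_integral f).toLp _) (norm_nonneg f) (by
      filter_upwards [(hk.memLp_integral f).coeFn_toLp] with x hx
      rw [hx]
      exact hk.abs_inner_section_le x f)
    simpa [measureUnivNNReal] using h

theorem coeFn_op (hk : IsKernel k) (f : L2D) :
    hk.op f =ᵐ[measD] fun x => ⟪hk.section_ x, f⟫_ℝ := (hk.memLp_integral f).coeFn_toLp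

/-- Fubini's theorem for the integral operator. -/
theorem integral_op_mul (hk : IsKernel k) (f : L2D) {ψ : ℝ → ℝ} (hψ : Integrable ψ measD) :
    ∫ x, hk.op f x * ψ x ∂measD = ∫ y, f y * ∫ x, k x y * ψ x ∂measD ∂measD := by
  have h1 : ∫ x, hk.op f x * ψ x ∂measD = ∫ x, ∫ y, k x y * (ψ x * f y) ∂measD ∂measD := by
    refine integral_congr_ae ?_
    filter_upwards [hk.coeFn_op f] with x hx
    rw [hx, inner_section, ← integral_mul_const]
    exact integral_congr_ae (Filter.Eventually.of_forall fun y => by simp only; ring)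
  rw [h1, integral_integral_swap (hk.integrable_prod (L2D.integrable f) hψ)]
  refine integral_congr_ae (Filter.Eventually.of_forall fun y => ?_)
  simp only
  rw [← integral_const_mul]
  exact integral_congr_ae (Filter.Eventually.of_forall fun x => by simp only; ring)

end IsKernel

/-! ### The Green operator of `-∂ₓ²` with Dirichlet boundary conditions -/

/-- Green's function `min(x,y) - xy` of `-∂ₓ²` on `D` with Dirichlet boundary conditions, cut off
for `x ∉ [0,1]` so as to be bounded. -/
def green (x y : ℝ) : ℝ := if x ∈ Icc (0 : ℝ) 1 then min x y - x * y else 0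

/-- The derivative `1_{x < y} - y` of Green's function in its first variable. -/
def greenDeriv (x y : ℝ) : ℝ := (if x < y then 1 else 0) - y

theorem green_of_le {x y : ℝ} (h0 : 0 ≤ x) (h1 : x ≤ 1) (h : x ≤ y) :
    green x y = x * (1 - y) := by
  rw [green, if_pos ⟨h0, h1⟩, min_eq_left h]; ring

theorem green_of_ge {x y : ℝ} (h0 : 0 ≤ x) (h1 : x ≤ 1) (h : y ≤ x) :
    green x y = y * (1 - x) := by
  rw [green, if_pos ⟨h0, h1⟩, min_eq_right h]; ring

theorem green_comm {x y : ℝ} (hx : x ∈ Icc (0 : ℝ) 1) (hy : y ∈ Icc (0 : ℝ) 1) :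
    green x y = green y x := by
  rw [green, green, if_pos hx, if_pos hy, min_comm, mul_comm]

theorem isKernel_green : IsKernel green where
  meas := by
    have : Function.uncurry green =
        fun z : ℝ × ℝ => if z.1 ∈ Icc (0 : ℝ) 1 then min z.1 z.2 - z.1 * z.2 else 0 := rfl
    rw [this]
    exact Measurable.ite (measurable_fst measurableSet_Icc) (by fun_prop) measurable_const
  bound x y hy := by
    by_cases hx : x ∈ Icc (0 : ℝ) 1
    · rw [abs_le]
      rcases le_total x y with h | h
      · rw [green_of_le hx.1 hx.2 h]
        constructor <;> nlinarith [hx.1, hx.2, hy.1, hy.2]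
      · rw [green_of_ge hx.1 hx.2 h]
        constructor <;> nlinarith [hx.1, hx.2, hy.1, hy.2]
    · simp [green, hx]

theorem isKernel_greenDeriv : IsKernel greenDeriv where
  meas := by
    have : Function.uncurry greenDeriv =
        fun z : ℝ × ℝ => (if z.1 < z.2 then 1 else 0) - z.2 := rfl
    rw [this]
    exact (Measurable.ite (measurableSet_lt measurable_fst measurable_snd) measurable_const
      measurable_const).sub measurable_snd
  bound x y hy := by
    rw [greenDeriv, abs_le]
    split_ifs <;> constructor <;> linarith [hy.1, hy.2]

/-- The Green operator `G = (-∂ₓ²)⁻¹`. -/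
def greenOp : L2D →L[ℝ] L2D := isKernel_green.op

theorem coeFn_greenOp (f : L2D) :
    greenOp f =ᵐ[measD] fun x => ⟪isKernel_green.section_ x, f⟫_ℝ := isKernel_green.coeFn_op f

theorem greenOp_symm (f g : L2D) : ⟪greenOp f, g⟫_ℝ = ⟪f, greenOp g⟫_ℝ := by
  rw [L2D.inner_eq, greenOp, isKernel_green.integral_op_mul f (L2D.integrable g), L2D.inner_eq]
  refine integral_congr_ae ?_
  filter_upwards [coeFn_greenOp g, ae_restrict_mem measurableSet_Ioo] with y h1 hy
  rw [← greenOp, h1, isKernel_green.inner_section]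
  congr 1
  refine integral_congr_ae ?_
  filter_upwards [ae_restrict_mem measurableSet_Ioo] with x hx
  rw [green_comm (Ioo_subset_Icc_self hx) (Ioo_subset_Icc_self hy)]

theorem setIntegral_Ioo_eq {f : ℝ → ℝ} {a b : ℝ} (h : a ≤ b) :
    ∫ x in Ioo a b, f x = ∫ x in a..b, f x := by
  rw [← integral_Ioc_eq_integral_Ioo, intervalIntegral.integral_of_le h]

theorem integral_greenDeriv_mul_deriv {φ : ℝ → ℝ} (hφ : IsTest 0 1 φ) {y : ℝ}
    (hy : y ∈ Ioo (0 : ℝ) 1) : ∫ x, greenDeriv x y * deriv φ x ∂measD = φ y := by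
  have hi : ∀ a b, IntervalIntegrable (deriv φ) volume a b := fun a b =>
    hφ.deriv.continuous.intervalIntegrable a b
  have hftc : ∀ a b, ∫ x in a..b, deriv φ x = φ b - φ a := fun a b =>
    intervalIntegral.integral_deriv_eq_sub (fun x _ => hφ.differentiable x) (hi a b)
  have h1 : ∫ x, greenDeriv x y * deriv φ x ∂measD
      = (∫ x in Ioo (0 : ℝ) 1, (Iio y).indicator (deriv φ) x)
        - y * ∫ x in Ioo (0 : ℝ) 1, deriv φ x := by
    rw [← integral_const_mul, ← integral_sub]
    · refine integral_congr_ae (Filter.Eventually.of_forall fun x => ?_)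
      by_cases hxy : x < y <;> simp [greenDeriv, hxy, indicator, sub_mul]
    · exact (hφ.deriv.integrable.indicator measurableSet_Iio).integrableOn
    · exact hφ.deriv.integrable.integrableOn.const_mul y
  rw [h1, setIntegral_indicator measurableSet_Iio, Ioo_inter_Iio, min_eq_right hy.2.le,
    setIntegral_Ioo_eq hy.1.le, setIntegral_Ioo_eq zero_le_one, hftc, hftc,
    hφ.eq_zero_of_notMem (x := 0) (by simp), hφ.eq_zero_of_notMem (x := 1) (by simp)]
  ring

theorem integral_green_mul_deriv {φ : ℝ → ℝ} (hφ : IsTest 0 1 φ) {y : ℝ}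
    (hy : y ∈ Ioo (0 : ℝ) 1) :
    ∫ x, green x y * deriv φ x ∂measD = - ∫ x, greenDeriv x y * φ x ∂measD := by
  have hi : ∀ a b, IntervalIntegrable φ volume a b := fun a b =>
    hφ.continuous.intervalIntegrable a b
  have hi' : ∀ a b, IntervalIntegrable (deriv φ) volume a b := fun a b =>
    hφ.deriv.continuous.intervalIntegrable a b
  have ga : IntervalIntegrable (fun x => green x y * deriv φ x) volume 0 y :=
    (show ContinuousOn (fun x => (x * (1 - y)) * deriv φ x) (uIcc 0 y) from
      ((by fun_prop : Continuous fun x : ℝ => x * (1 - y)).mul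
        hφ.deriv.continuous).continuousOn).intervalIntegrable.congr_uIoo fun x hx => by
      rw [uIoo_of_le hy.1.le] at hx
      simp only
      rw [green_of_le hx.1.le (hx.2.trans hy.2).le hx.2.le]
  have gb : IntervalIntegrable (fun x => green x y * deriv φ x) volume y 1 :=
    (show ContinuousOn (fun x => (y * (1 - x)) * deriv φ x) (uIcc y 1) from
      ((by fun_prop : Continuous fun x : ℝ => y * (1 - x)).mul
        hφ.deriv.continuous).continuousOn).intervalIntegrable.congr_uIoo fun x hx => by
      rw [uIoo_of_le hy.2.le] at hx
      simp only
      rw [green_of_ge (hy.1.trans hx.1).le hx.2.le hx.1.le]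
  have h1 : ∫ x in (0 : ℝ)..y, green x y * deriv φ x
      = y * (1 - y) * φ y - ∫ x in (0 : ℝ)..y, (1 - y) * φ x := by
    rw [intervalIntegral.integral_congr (g := fun x => (x * (1 - y)) * deriv φ x),
      intervalIntegral.integral_mul_deriv_eq_deriv_mul (u' := fun _ => 1 - y)
        (fun x _ => by simpa using (hasDerivAt_id x).mul_const (1 - y))
        (fun x _ => hφ.hasDerivAt x) (by simp) (hi' _ _)]
    · simp
    · intro x hx
      rw [uIcc_of_le hy.1.le] at hx
      simp only
      rw [green_of_le hx.1 (hx.2.trans hy.2.le) hx.2]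
  have h2 : ∫ x in y..1, green x y * deriv φ x
      = - (y * (1 - y) * φ y) - ∫ x in y..1, (-y) * φ x := by
    rw [intervalIntegral.integral_congr (g := fun x => (y * (1 - x)) * deriv φ x),
      intervalIntegral.integral_mul_deriv_eq_deriv_mul (u' := fun _ => -y)
        (fun x _ => by simpa using ((hasDerivAt_id x).const_sub 1).const_mul y)
        (fun x _ => hφ.hasDerivAt x) (by simp) (hi' _ _)]
    · simp
    · intro x hx
      rw [uIcc_of_le hy.2.le] at hx
      simp only
      rw [green_of_ge (hy.1.le.trans hx.1) hx.2 hx.1]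
  have h3 : ∫ x, greenDeriv x y * φ x ∂measD
      = (∫ x in Ioo (0 : ℝ) 1, (Iio y).indicator φ x) - y * ∫ x in Ioo (0 : ℝ) 1, φ x := by
    rw [← integral_const_mul, ← integral_sub]
    · refine integral_congr_ae (Filter.Eventually.of_forall fun x => ?_)
      by_cases hxy : x < y <;> simp [greenDeriv, hxy, indicator, sub_mul]
    · exact (hφ.integrable.indicator measurableSet_Iio).integrableOn
    · exact hφ.integrable.integrableOn.const_mul y
  rw [h3, setIntegral_indicator measurableSet_Iio, Ioo_inter_Iio, min_eq_right hy.2.le,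
    setIntegral_Ioo_eq hy.1.le, setIntegral_Ioo_eq zero_le_one, setIntegral_Ioo_eq zero_le_one,
    ← intervalIntegral.integral_add_adjacent_intervals ga gb, h1, h2,
    ← intervalIntegral.integral_add_adjacent_intervals (hi 0 y) (hi y 1),
    intervalIntegral.integral_const_mul, intervalIntegral.integral_const_mul]
  ring

/-! ### The space `H²(D) ∩ H¹₀(D)` as the range of the Green operator -/

theorem hasWeakDeriv_iff {f g : L2D} : HasWeakDeriv f g ↔
    ∀ φ, IsTest 0 1 φ → ∫ x, f x * deriv φ x ∂measD = - ∫ x, g x * φ x ∂measD :=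
  ⟨fun h φ hφ => h φ hφ.smooth hφ.compact hφ.subset, fun h φ h1 h2 h3 => h φ ⟨h1, h2, h3⟩⟩

theorem HasWeakDeriv.unique {f g g' : L2D} (h : HasWeakDeriv f g) (h' : HasWeakDeriv f g') :
    g = g' := by
  rw [hasWeakDeriv_iff] at h h'
  refine Lp.ext ?_
  have := ae_eq_zero_of_forall_isTest (a := 0) (b := 1) (f := fun x => g x - g' x)
    ((L2D.integrable g).sub (L2D.integrable g')) fun φ hφ => by
      simp_rw [sub_mul]
      rw [integral_sub (integrableOn_mul_isTest (L2D.integrable g) hφ)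
        (integrableOn_mul_isTest (L2D.integrable g') hφ)]
      linarith [h φ hφ, h' φ hφ]
  filter_upwards [this] with x hx using sub_eq_zero.mp hx

theorem HasWeakDeriv.weakDeriv_eq {f g : L2D} (h : HasWeakDeriv f g) : weakDeriv f = g := by
  have hex : ∃ g, HasWeakDeriv f g := ⟨g, h⟩
  rw [weakDeriv, dif_pos hex]
  exact hex.choose_spec.unique h

theorem HasWeakDeriv.add {f f' g g' : L2D} (h : HasWeakDeriv f g) (h' : HasWeakDeriv f' g') :
    HasWeakDeriv (f + f') (g + g') := by
  rw [hasWeakDeriv_iff] at *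
  have hsum : ∀ (u v : L2D) (φ : ℝ → ℝ), IsTest 0 1 φ → ∫ x, (u + v : L2D) x * φ x ∂measD
      = ∫ x, u x * φ x ∂measD + ∫ x, v x * φ x ∂measD := fun u v φ hφ => by
    rw [← integral_add (integrableOn_mul_isTest (L2D.integrable u) hφ)
      (integrableOn_mul_isTest (L2D.integrable v) hφ)]
    refine integral_congr_ae ?_
    filter_upwards [Lp.coeFn_add u v] with x hx
    rw [hx, Pi.add_apply, add_mul]
  intro φ hφ
  rw [hsum f f' _ hφ.deriv, hsum g g' _ hφ, h φ hφ, h' φ hφ]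
  ring

theorem hasWeakDeriv_greenOp (f : L2D) :
    HasWeakDeriv (greenOp f) (isKernel_greenDeriv.op f) := by
  rw [hasWeakDeriv_iff]
  intro φ hφ
  rw [greenOp, isKernel_green.integral_op_mul f hφ.deriv.integrable.integrableOn,
    isKernel_greenDeriv.integral_op_mul f hφ.integrable.integrableOn, ← integral_neg]
  refine integral_congr_ae ?_
  filter_upwards [ae_restrict_mem measurableSet_Ioo] with y hy
  rw [integral_green_mul_deriv hφ hy, mul_neg]

theorem hasWeakDeriv_greenDerivOp (f : L2D) :
    HasWeakDeriv (isKernel_greenDeriv.op f) (-f) := by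
  rw [hasWeakDeriv_iff]
  intro φ hφ
  rw [isKernel_greenDeriv.integral_op_mul f hφ.deriv.integrable.integrableOn, ← integral_neg]
  refine integral_congr_ae ?_
  filter_upwards [ae_restrict_mem measurableSet_Ioo, Lp.coeFn_neg f] with y hy h1
  rw [integral_greenDeriv_mul_deriv hφ hy, h1, Pi.neg_apply, neg_mul, neg_neg]

theorem weakDeriv_weakDeriv_greenOp (f : L2D) : weakDeriv (weakDeriv (greenOp f)) = -f := by
  rw [(hasWeakDeriv_greenOp f).weakDeriv_eq, (hasWeakDeriv_greenDerivOp f).weakDeriv_eq]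

theorem greenOp_injective : Function.Injective greenOp := fun f g h => by
  have := congrArg (fun w => weakDeriv (weakDeriv w)) h
  simpa only [weakDeriv_weakDeriv_greenOp, neg_inj] using this

theorem abs_green_sub_le {x x' y : ℝ} (hx : x ∈ Icc (0 : ℝ) 1) (hx' : x' ∈ Icc (0 : ℝ) 1)
    (hy : y ∈ Icc (0 : ℝ) 1) : |green x y - green x' y| ≤ |x - x'| := by
  wlog hle : x ≤ x' generalizing x x'
  · rw [abs_sub_comm, abs_sub_comm x]
    exact this hx' hx (not_le.mp hle).le
  rw [abs_sub_comm x, abs_of_nonneg (sub_nonneg.mpr hle), green, green, if_pos hx, if_pos hx',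
    abs_le]
  have h1 := min_le_min_right y hle
  have h2 : min x' y ≤ min x y + (x' - x) := by
    rw [← min_add_add_right]
    exact le_min (by linarith [min_le_left x' y]) (by linarith [min_le_right x' y])
  constructor <;> nlinarith [hy.1, hy.2, mul_nonneg hy.1 (sub_nonneg.mpr hle),
    mul_nonneg (sub_nonneg.mpr hy.2) (sub_nonneg.mpr hle)]

theorem memH10_greenOp (f : L2D) : MemH10 (greenOp f) := by
  refine ⟨⟨_, hasWeakDeriv_greenOp f⟩, fun x => ⟪isKernel_green.section_ x, f⟫_ℝ, ?_,
    coeFn_greenOp f, ?_, ?_⟩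
  · have hL : LipschitzOnWith ‖f‖₊ (fun x => ⟪isKernel_green.section_ x, f⟫_ℝ)
        (Icc (0 : ℝ) 1) := by
      refine LipschitzOnWith.of_dist_le_mul fun x hx x' hx' => ?_
      rw [Real.dist_eq, Real.dist_eq, ← inner_sub_left, coe_nnnorm, mul_comm]
      refine (abs_real_inner_le_norm _ _).trans (mul_le_mul_of_nonneg_right ?_ (norm_nonneg f))
      have h := Lp.norm_le_of_ae_bound
        (f := isKernel_green.section_ x - isKernel_green.section_ x') (abs_nonneg (x - x')) (by
        filter_upwards [Lp.coeFn_sub (isKernel_green.section_ x) (isKernel_green.section_ x'),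
          isKernel_green.coeFn_section x, isKernel_green.coeFn_section x',
          ae_restrict_mem measurableSet_Ioo] with y h1 h2 h3 hy
        rw [h1, Pi.sub_apply, h2, h3]
        exact abs_green_sub_le hx hx' (Ioo_subset_Icc_self hy))
      simpa [measureUnivNNReal] using h
    exact hL.continuousOn
  · simp only [isKernel_green.inner_section]
    refine integral_eq_zero_of_ae ?_
    filter_upwards [ae_restrict_mem measurableSet_Ioo] with y hy
    rw [green_of_le le_rfl zero_le_one hy.1.le]
    simp
  · simp only [isKernel_green.inner_section]
    refine integral_eq_zero_of_ae ?_
    filter_upwards [ae_restrict_mem measurableSet_Ioo] with y hy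
    rw [green_of_ge zero_le_one le_rfl hy.2.le]
    simp

theorem greenOp_mem_H2H10 (f : L2D) : greenOp f ∈ H2H10 :=
  ⟨⟨_, _, hasWeakDeriv_greenOp f, hasWeakDeriv_greenDerivOp f⟩, memH10_greenOp f⟩

/-- On a subinterval of `D` on which the weak derivative of `f` is a polynomial, `f` is a
polynomial. -/
theorem HasWeakDeriv.ae_polynomial {f g : L2D} (h : HasWeakDeriv f g) {a b : ℝ} (hab : a < b)
    (hsub : Ioo a b ⊆ Ioo 0 1) {r : Polynomial ℝ}
    (hr : ∀ᵐ x ∂volume.restrict (Ioo a b), g x = r.eval x) :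
    ∃ q : Polynomial ℝ, Polynomial.derivative q = r ∧ q.natDegree ≤ r.natDegree + 1 ∧
      ∀ᵐ x ∂volume.restrict (Ioo a b), f x = q.eval x := by
  refine ae_polynomial_of_weakDeriv hab (IntegrableOn.mono_set (L2D.integrable f) hsub)
    (fun φ hφ => ?_) hr
  rw [← hφ.setIntegral_mul hsub, ← hφ.deriv.setIntegral_mul hsub]
  exact hasWeakDeriv_iff.mp h φ (hφ.mono hsub)

/-- Uniqueness for the Dirichlet problem: a function with vanishing second weak derivative is affine,
so that it vanishes if its boundary values do. -/
theorem eq_zero_of_weakDeriv_weakDeriv_zero {f g : L2D} (hg : HasWeakDeriv f g)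
    (h0 : HasWeakDeriv g 0) {c : ℝ → ℝ} (hc : ContinuousOn c (Icc 0 1)) (hfc : f =ᵐ[measD] c)
    (hc0 : c 0 = 0) (hc1 : c 1 = 0) : f = 0 := by
  obtain ⟨r, hr, -, hgr⟩ := h0.ae_polynomial (r := 0) zero_lt_one subset_rfl (by
    filter_upwards [Lp.coeFn_zero ℝ 2 measD] with x hx
    rw [hx]; simp)
  obtain ⟨q, hq, -, hfq⟩ := hg.ae_polynomial zero_lt_one subset_rfl hgr
  have hcq : EqOn c (fun x => q.eval x) (Icc 0 1) := by
    have hae : c =ᵐ[volume.restrict (Ioo 0 1)] fun x => q.eval x := by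
      filter_upwards [hfc, hfq] with x h1 h2
      rw [← h1, h2]
    have hO := Measure.eqOn_open_of_ae_eq hae isOpen_Ioo (hc.mono Ioo_subset_Icc_self)
      q.continuous.continuousOn
    refine hO.of_subset_closure hc q.continuous.continuousOn Ioo_subset_Icc_self ?_
    rw [closure_Ioo zero_ne_one]
  have hr' := Polynomial.eq_C_of_derivative_eq_zero hr
  have hlin : ∀ x, q.eval x = q.eval 0 + r.coeff 0 * x := by
    have hd : Polynomial.derivative (q - Polynomial.C (r.coeff 0) * Polynomial.X) = 0 := by
      rw [Polynomial.derivative_sub, hq, Polynomial.derivative_C_mul_X, ← hr', sub_self]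
    have hC := Polynomial.eq_C_of_derivative_eq_zero hd
    intro x
    have h1 := congrArg (Polynomial.eval x) hC
    have h2 := congrArg (Polynomial.eval 0) hC
    simp only [Polynomial.eval_sub, Polynomial.eval_mul, Polynomial.eval_C,
      Polynomial.eval_X] at h1 h2
    linarith
  have e0 : q.eval 0 = 0 := (hcq (left_mem_Icc.mpr zero_le_one)).symm.trans hc0
  have e1 : q.eval 1 = 0 := (hcq (right_mem_Icc.mpr zero_le_one)).symm.trans hc1
  have e2 : r.coeff 0 = 0 := by linarith [hlin 1]
  refine Lp.ext ?_
  filter_upwards [hfq, Lp.coeFn_zero ℝ 2 measD] with x h1 h2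
  rw [h1, h2, hlin, e0, e2]
  simp

theorem greenOp_of_hasWeakDeriv {f g₁ g₂ : L2D} (h0 : MemH10 f) (h1 : HasWeakDeriv f g₁)
    (h2 : HasWeakDeriv g₁ g₂) : f = greenOp (-g₂) := by
  obtain ⟨c, hc, hfc, hc0, hc1⟩ := h0.2
  obtain ⟨c', hc', hfc', hc0', hc1'⟩ := (memH10_greenOp g₂).2
  have h : f + greenOp g₂ = 0 := by
    refine eq_zero_of_weakDeriv_weakDeriv_zero (h1.add (hasWeakDeriv_greenOp g₂)) ?_
      (hc.add hc') ?_ (by simp [hc0, hc0']) (by simp [hc1, hc1'])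
    · simpa using h2.add (hasWeakDeriv_greenDerivOp g₂)
    · filter_upwards [Lp.coeFn_add f (greenOp g₂), hfc, hfc'] with x e1 e2 e3
      rw [e1, Pi.add_apply, Pi.add_apply, e2, e3]
  rw [map_neg]
  exact eq_neg_of_add_eq_zero_left h

/-- `H²(D) ∩ H¹₀(D)` is the range of the Green operator. -/
theorem mem_H2H10_iff {f : L2D} : f ∈ H2H10 ↔ ∃ g, greenOp g = f := by
  constructor
  · rintro ⟨⟨g₁, g₂, h1, h2⟩, h0⟩
    exact ⟨-g₂, (greenOp_of_hasWeakDeriv h0 h1 h2).symm⟩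
  · rintro ⟨g, rfl⟩
    exact greenOp_mem_H2H10 g

theorem bform_greenOp (f g : L2D) : bform (greenOp f) (greenOp g) = ⟪f, g⟫_ℝ := by
  rw [bform, weakDeriv_weakDeriv_greenOp, weakDeriv_weakDeriv_greenOp, inner_neg_neg]

/-! ### The sine functions -/

theorem hasWeakDeriv_toLp {f f' : ℝ → ℝ} (hf : ∀ x, HasDerivAt f (f' x) x)
    (hf' : Continuous f') (h1 : MemLp f 2 measD) (h2 : MemLp f' 2 measD) :
    HasWeakDeriv (h1.toLp f) (h2.toLp f') := by
  rw [hasWeakDeriv_iff]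
  intro φ hφ
  have e1 : ∫ x, h1.toLp f x * deriv φ x ∂measD = ∫ x in (0 : ℝ)..1, f x * deriv φ x := by
    rw [← setIntegral_Ioo_eq zero_le_one]
    refine integral_congr_ae ?_
    filter_upwards [h1.coeFn_toLp] with x hx
    rw [hx]
  have e2 : ∫ x, h2.toLp f' x * φ x ∂measD = ∫ x in (0 : ℝ)..1, f' x * φ x := by
    rw [← setIntegral_Ioo_eq zero_le_one]
    refine integral_congr_ae ?_
    filter_upwards [h2.coeFn_toLp] with x hx
    rw [hx]
  rw [e1, e2, intervalIntegral.integral_mul_deriv_eq_deriv_mul (fun x _ => hf x)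
    (fun x _ => hφ.hasDerivAt x) (hf'.intervalIntegrable _ _)
    (hφ.deriv.continuous.intervalIntegrable _ _),
    hφ.eq_zero_of_notMem (x := 0) (by simp), hφ.eq_zero_of_notMem (x := 1) (by simp)]
  ring

/-- `ε_k` is an eigenfunction of the Green operator. -/
theorem greenOp_epsL2 {k : ℕ} (hk : 1 ≤ k) :
    greenOp (epsL2 k) = ((k * Real.pi) ^ 2)⁻¹ • epsL2 k := by
  set l : ℝ := k * Real.pi with hl
  have hlpos : 0 < l := by positivity
  have hd1 : ∀ x, HasDerivAt (eps k) (√2 * l * Real.cos (l * x)) x := fun x =>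
    ((((hasDerivAt_id' x).const_mul l).sin).const_mul √2).congr_deriv (by ring)
  have hd2 : ∀ x, HasDerivAt (fun x => √2 * l * Real.cos (l * x)) ((-l ^ 2) * eps k x) x :=
    fun x => ((((hasDerivAt_id' x).const_mul l).cos).const_mul (√2 * l)).congr_deriv (by
      rw [eps]; ring)
  have hm1 : MemLp (fun x => √2 * l * Real.cos (l * x)) 2 measD :=
    MemLp.of_bound (by fun_prop) |√2 * l| (Filter.Eventually.of_forall fun x => by
      rw [norm_mul]
      exact mul_le_of_le_one_right (abs_nonneg _) (Real.abs_cos_le_one _))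
  have hc : Continuous (eps k) := by unfold eps; fun_prop
  have w1 := hasWeakDeriv_toLp hd1 (by fun_prop) (memLp_eps k) hm1
  have w2 := hasWeakDeriv_toLp hd2 (by fun_prop) hm1 ((memLp_eps k).const_mul (-l ^ 2))
  have e2 : ((memLp_eps k).const_mul (-l ^ 2)).toLp _ = (-l ^ 2) • epsL2 k :=
    MemLp.toLp_const_smul (-l ^ 2) (memLp_eps k)
  rw [e2] at w2
  have h10 : MemH10 (epsL2 k) := by
    refine ⟨⟨_, w1⟩, eps k, hc.continuousOn, (memLp_eps k).coeFn_toLp, by simp [eps], ?_⟩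
    rw [eps, mul_one, Real.sin_nat_mul_pi, mul_zero]
  have h := greenOp_of_hasWeakDeriv h10 w1 w2
  rw [← neg_smul, neg_neg, map_smul] at h
  rw [eq_inv_smul_iff₀ (pow_ne_zero 2 hlpos.ne')]
  exact h.symm

theorem norm_epsL2 {k : ℕ} (hk : 1 ≤ k) : ‖epsL2 k‖ = 1 := by
  have hl : (k * Real.pi : ℝ) ≠ 0 := by positivity
  have h : ‖epsL2 k‖ ^ 2 = 1 := by
    rw [L2D.norm_sq_eq]
    have : ∫ x, epsL2 k x ^ 2 ∂measD = ∫ x in (0 : ℝ)..1, 2 * Real.sin (k * Real.pi * x) ^ 2 := by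
      rw [← setIntegral_Ioo_eq zero_le_one]
      refine integral_congr_ae ?_
      filter_upwards [(memLp_eps k).coeFn_toLp] with x hx
      rw [epsL2, hx, eps, mul_pow, Real.sq_sqrt zero_le_two]
    rw [this, intervalIntegral.integral_const_mul,
      intervalIntegral.integral_comp_mul_left (fun x => Real.sin x ^ 2) hl, integral_sin_sq]
    simp only [mul_zero, mul_one, Real.sin_zero, Real.sin_nat_mul_pi, smul_eq_mul]
    field_simp
    ring
  exact (sq_eq_sq₀ (norm_nonneg _) zero_le_one).mp (by rw [h, one_pow])

theorem inner_epsL2_of_ne {i j : ℕ} (hi : 1 ≤ i) (hj : 1 ≤ j) (hij : i ≠ j) :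
    ⟪epsL2 i, epsL2 j⟫_ℝ = 0 := by
  have h := greenOp_symm (epsL2 i) (epsL2 j)
  rw [greenOp_epsL2 hi, greenOp_epsL2 hj, real_inner_smul_left, real_inner_smul_right,
    ← sub_eq_zero, ← sub_mul] at h
  refine (mul_eq_zero.mp h).resolve_left (sub_ne_zero.mpr fun h' => hij ?_)
  have hpi := Real.pi_pos
  rw [inv_inj, sq_eq_sq₀ (by positivity) (by positivity), mul_left_inj' hpi.ne'] at h'
  exact_mod_cast h'

theorem orthonormal_epsL2 : Orthonormal ℝ fun i : {i : ℕ // 1 ≤ i} => epsL2 i :=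
  ⟨fun i => norm_epsL2 i.2, fun i j hij => inner_epsL2_of_ne i.2 j.2 fun h => hij (Subtype.ext h)⟩

/-! ### The finite element space as the image of discontinuous piecewise polynomials -/

namespace Mesh

variable (X : Mesh)

/-- The `j`-th interval of the partition. -/
def cell (j : Fin X.J) : Set ℝ := Ioo (X.node j.castSucc) (X.node j.succ)

theorem node_lt (j : Fin X.J) : X.node j.castSucc < X.node j.succ :=
  X.strictMono (Fin.castSucc_lt_succ (i := j))

theorem node_nonneg (i : Fin (X.J + 1)) : 0 ≤ X.node i := by
  rw [← X.node_zero]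
  exact X.strictMono.monotone (Fin.zero_le i)

theorem node_le_one (i : Fin (X.J + 1)) : X.node i ≤ 1 := by
  rw [← X.node_last]
  exact X.strictMono.monotone (Fin.le_last i)

theorem cell_subset (j : Fin X.J) : X.cell j ⊆ Ioo 0 1 :=
  Ioo_subset_Ioo (X.node_nonneg _) (X.node_le_one _)

theorem length_le_size (j : Fin X.J) : X.node j.succ - X.node j.castSucc ≤ X.size :=
  le_ciSup (f := fun j : Fin X.J => X.node j.succ - X.node j.castSucc)
    (Set.finite_range _).bddAbove j

theorem nonempty_fin : Nonempty (Fin X.J) := by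
  refine Fin.pos_iff_nonempty.mp (Nat.pos_of_ne_zero fun h => ?_)
  have h0 : (0 : Fin (X.J + 1)) = Fin.last X.J := Fin.ext (by simp [h])
  have := X.node_zero
  rw [h0, X.node_last] at this
  exact one_ne_zero this

theorem size_pos : 0 < X.size := by
  obtain ⟨j⟩ := X.nonempty_fin
  exact (sub_pos.mpr (X.node_lt j)).trans_le (X.length_le_size j)

theorem size_le_one : X.size ≤ 1 := by
  have := X.nonempty_fin
  exact ciSup_le fun j => by linarith [X.node_nonneg j.castSucc, X.node_le_one j.succ]

theorem notMem_cell_of_ne {i j : Fin X.J} (hij : i ≠ j) {x : ℝ} (hx : x ∈ X.cell j) :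
    x ∉ X.cell i := fun hi => by
  rcases lt_or_gt_of_ne hij with h | h
  · have := X.strictMono.monotone (Fin.succ_le_castSucc_iff.mpr h)
    linarith [hi.2, hx.1]
  · have := X.strictMono.monotone (Fin.succ_le_castSucc_iff.mpr h)
    linarith [hi.1, hx.2]

theorem ae_exists_mem_cell : ∀ᵐ x ∂measD, ∃ j, x ∈ X.cell j := by
  have hnode : ∀ᵐ x ∂measD, x ∉ range X.node :=
    measure_eq_zero_iff_ae_notMem.mp
      (Measure.absolutelyContinuous_of_le Measure.restrict_le_self
        ((Set.finite_range X.node).measure_zero volume))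
  filter_upwards [hnode, ae_restrict_mem measurableSet_Ioo] with x hx h01
  by_contra! hne
  have hall : ∀ i : Fin (X.J + 1), X.node i < x := fun i => by
    induction i using Fin.induction with
    | zero => rw [X.node_zero]; exact h01.1
    | succ i ih =>
      rcases lt_trichotomy (X.node i.succ) x with h | h | h
      · exact h
      · exact absurd ⟨_, h⟩ hx
      · exact absurd ⟨ih, h⟩ (hne i)
  have := hall (Fin.last X.J)
  rw [X.node_last] at this
  exact lt_asymm this h01.2

end Mesh

theorem memLp_polynomial (q : Polynomial ℝ) : MemLp (fun x => q.eval x) 2 measD := by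
  obtain ⟨B, hB⟩ := isCompact_Icc.exists_bound_of_continuousOn (s := Icc (0 : ℝ) 1)
    q.continuous.continuousOn
  refine MemLp.of_bound q.continuous.aestronglyMeasurable B ?_
  filter_upwards [ae_restrict_mem measurableSet_Ioo] with x hx
    using hB x (Ioo_subset_Icc_self hx)

/-- The functions in `L²(D)` that are polynomials of degree at most `d` on every interval of the
partition, without any continuity across the nodes. -/
def piecewisePoly (d : ℕ) (X : Mesh) : Submodule ℝ L2D where
  carrier := {v | ∀ j, ∃ q : Polynomial ℝ, q.natDegree ≤ d ∧
    ∀ᵐ x ∂volume.restrict (X.cell j), v x = q.eval x}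
  add_mem' {v w} hv hw j := by
    obtain ⟨q, hq, hv⟩ := hv j
    obtain ⟨r, hr, hw⟩ := hw j
    refine ⟨q + r, Polynomial.natDegree_add_le_of_degree_le hq hr, ?_⟩
    filter_upwards [hv, hw, ae_restrict_of_ae_restrict_of_subset (X.cell_subset j)
      (Lp.coeFn_add v w)] with x h1 h2 h3
    rw [h3, Pi.add_apply, h1, h2, Polynomial.eval_add]
  zero_mem' j := by
    refine ⟨0, by simp, ?_⟩
    filter_upwards [ae_restrict_of_ae_restrict_of_subset (X.cell_subset j)
      (Lp.coeFn_zero ℝ 2 measD)] with x h1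
    rw [h1, Pi.zero_apply, Polynomial.eval_zero]
  smul_mem' c v hv j := by
    obtain ⟨q, hq, hv⟩ := hv j
    refine ⟨c • q, (Polynomial.natDegree_smul_le c q).trans hq, ?_⟩
    filter_upwards [hv, ae_restrict_of_ae_restrict_of_subset (X.cell_subset j)
      (Lp.coeFn_smul c v)] with x h1 h2
    rw [h2, Pi.smul_apply, h1, Polynomial.eval_smul]

theorem HasWeakDeriv.ae_derivative {f g : L2D} (h : HasWeakDeriv f g) {a b : ℝ}
    (hsub : Ioo a b ⊆ Ioo 0 1) {q : Polynomial ℝ}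
    (hq : ∀ᵐ x ∂volume.restrict (Ioo a b), f x = q.eval x) :
    ∀ᵐ x ∂volume.restrict (Ioo a b), g x = (Polynomial.derivative q).eval x := by
  have hgi : IntegrableOn g (Ioo a b) := IntegrableOn.mono_set (L2D.integrable g) hsub
  have hqi : IntegrableOn (fun x => (Polynomial.derivative q).eval x) (Ioo a b) :=
    ((Polynomial.continuous _).integrableOn_Icc (a := a) (b := b)).mono_set Ioo_subset_Icc_self
  have := ae_eq_zero_of_forall_isTest (hgi.sub hqi)
    (f := fun x => g x - (Polynomial.derivative q).eval x) fun φ hφ => by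
      have h1 := hasWeakDeriv_iff.mp h φ (hφ.mono hsub)
      rw [hφ.setIntegral_mul hsub, hφ.deriv.setIntegral_mul hsub] at h1
      have h2 := setIntegral_polynomial_mul_deriv q hφ
      have h3 : ∫ x in Ioo a b, f x * deriv φ x = ∫ x in Ioo a b, q.eval x * deriv φ x := by
        refine integral_congr_ae ?_
        filter_upwards [hq] with x hx
        rw [hx]
      simp_rw [sub_mul]
      rw [integral_sub (integrableOn_mul_isTest hgi hφ) (integrableOn_mul_isTest hqi hφ)]
      linarith
  filter_upwards [this] with x hx using sub_eq_zero.mp hx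

/-- In one dimension the second derivative maps the conforming finite element space onto the
discontinuous piecewise polynomials; its inverse is the Green operator. -/
theorem mem_feSpace_iff {d : ℕ} {X : Mesh} {χ : L2D} :
    χ ∈ feSpace (d + 2) X ↔ ∃ v ∈ piecewisePoly d X, greenOp v = χ := by
  constructor
  · rintro ⟨h, hpoly⟩
    obtain ⟨v, rfl⟩ := mem_H2H10_iff.mp h
    refine ⟨v, fun j => ?_, rfl⟩
    obtain ⟨q, hq, hae⟩ := hpoly j
    have h1 := (hasWeakDeriv_greenOp v).ae_derivative (X.cell_subset j) hae
    have h2 := (hasWeakDeriv_greenDerivOp v).ae_derivative (X.cell_subset j) h1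
    refine ⟨-Polynomial.derivative (Polynomial.derivative q), ?_, ?_⟩
    · rw [Polynomial.natDegree_neg]
      have e1 := Polynomial.natDegree_derivative_le q
      have e2 := Polynomial.natDegree_derivative_le (Polynomial.derivative q)
      lia
    · filter_upwards [h2, ae_restrict_of_ae_restrict_of_subset (X.cell_subset j)
        (Lp.coeFn_neg v)] with x e1 e2
      rw [e2, Pi.neg_apply] at e1
      rw [Polynomial.eval_neg, ← e1, neg_neg]
  · rintro ⟨v, hv, rfl⟩
    refine ⟨greenOp_mem_H2H10 v, fun j => ?_⟩
    obtain ⟨q, hq, hae⟩ := hv j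
    obtain ⟨r, -, hr, h1⟩ := (hasWeakDeriv_greenDerivOp v).ae_polynomial (X.node_lt j)
      (X.cell_subset j) (r := -q) (by
        filter_upwards [hae, ae_restrict_of_ae_restrict_of_subset (X.cell_subset j)
          (Lp.coeFn_neg v)] with x e1 e2
        rw [e2, Pi.neg_apply, e1, Polynomial.eval_neg])
    obtain ⟨s, -, hs, h2⟩ := (hasWeakDeriv_greenOp v).ae_polynomial (X.node_lt j)
      (X.cell_subset j) h1
    refine ⟨s, ?_, h2⟩
    rw [Polynomial.natDegree_neg] at hr
    lia

theorem exists_piecewisePoly {d : ℕ} (X : Mesh) (q : Fin X.J → Polynomial ℝ)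
    (hq : ∀ j, (q j).natDegree ≤ d) :
    ∃ v ∈ piecewisePoly d X, ∀ᵐ x ∂measD, ∃ j, x ∈ X.cell j ∧ v x = (q j).eval x := by
  set F : ℝ → ℝ := fun x => ∑ j, (X.cell j).indicator (fun x => (q j).eval x) x with hF
  have hmem : MemLp F 2 measD := memLp_finsetSum Finset.univ fun j _ =>
    (memLp_polynomial (q j)).indicator measurableSet_Ioo
  have hcell : ∀ j, ∀ x ∈ X.cell j, F x = (q j).eval x := fun j x hx => by
    rw [hF]
    simp only
    rw [Finset.sum_eq_single j (fun i _ hij => indicator_of_notMem (X.notMem_cell_of_ne hij hx) _)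
      (fun h => absurd (Finset.mem_univ j) h), indicator_of_mem hx]
  refine ⟨hmem.toLp F, fun j => ⟨q j, hq j, ?_⟩, ?_⟩
  · filter_upwards [ae_restrict_of_ae_restrict_of_subset (X.cell_subset j) hmem.coeFn_toLp,
      ae_restrict_mem (measurableSet_Ioo (a := X.node j.castSucc) (b := X.node j.succ))]
      with x h1 h2
    rw [h1, hcell j x h2]
  · filter_upwards [X.ae_exists_mem_cell, hmem.coeFn_toLp] with x ⟨j, hj⟩ h1
    exact ⟨j, hj, by rw [h1, hcell j x hj]⟩

/-! ### Approximation of Green's function by piecewise polynomials -/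

theorem norm_sq_section_sub_le {x : ℝ} {v : L2D} {b : ℝ → ℝ} (hb : Integrable b measD)
    (h : ∀ᵐ y ∂measD, (green x y - v y) ^ 2 ≤ b y) :
    ‖isKernel_green.section_ x - v‖ ^ 2 ≤ ∫ y, b y ∂measD := by
  rw [L2D.norm_sq_eq]
  refine integral_mono_ae (Lp.memLp _).integrable_sq hb ?_
  filter_upwards [h, Lp.coeFn_sub (isKernel_green.section_ x) v, isKernel_green.coeFn_section x]
    with y h1 h2 h3
  rwa [h2, Pi.sub_apply, h3]

theorem exists_approx_green_const (X : Mesh) {x : ℝ} (hx : x ∈ Icc (0 : ℝ) 1) :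
    ∃ v ∈ piecewisePoly 0 X, ‖isKernel_green.section_ x - v‖ ^ 2 ≤ X.size ^ 2 := by
  obtain ⟨v, hv, hae⟩ := exists_piecewisePoly (d := 0) X
    (fun j => Polynomial.C (green x (X.node j.castSucc))) (fun j => by simp)
  refine ⟨v, hv, (norm_sq_section_sub_le (integrable_const (X.size ^ 2)) ?_).trans (by simp)⟩
  filter_upwards [hae] with y ⟨j, hj, e⟩
  rw [e, Polynomial.eval_C]
  have hy := Ioo_subset_Icc_self (X.cell_subset j hj)
  have ha : X.node j.castSucc ∈ Icc (0 : ℝ) 1 := ⟨X.node_nonneg _, X.node_le_one _⟩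
  rw [green_comm hx hy, green_comm hx ha]
  refine sq_le_sq' ?_ ?_
  · linarith [neg_abs_le (green y x - green (X.node j.castSucc) x), abs_green_sub_le hy ha hx,
      abs_of_pos (sub_pos.mpr hj.1), hj.2, X.length_le_size j]
  · linarith [le_abs_self (green y x - green (X.node j.castSucc) x), abs_green_sub_le hy ha hx,
      abs_of_pos (sub_pos.mpr hj.1), hj.2, X.length_le_size j]

/-- Green's function `g(x, ·)` is affine off `x`, so that a piecewise affine approximation has an
error only on the part to the right of `x` of the interval containing `x`. -/
theorem exists_approx_green_affine (X : Mesh) {x : ℝ} (hx : x ∈ Icc (0 : ℝ) 1) :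
    ∃ v ∈ piecewisePoly 1 X, ‖isKernel_green.section_ x - v‖ ^ 2 ≤ X.size ^ 3 := by
  obtain ⟨v, hv, hae⟩ := exists_piecewisePoly (d := 1) X
    (fun j => if x ≤ X.node j.castSucc then Polynomial.C (-x) * Polynomial.X + Polynomial.C x
      else Polynomial.C (1 - x) * Polynomial.X + Polynomial.C 0)
    (fun j => by split_ifs <;> exact Polynomial.natDegree_linear_le)
  have hb : Integrable ((Ioo x (x + X.size)).indicator fun _ => X.size ^ 2) measD :=
    (integrable_const _).indicator measurableSet_Ioo
  refine ⟨v, hv, (norm_sq_section_sub_le hb ?_).trans ?_⟩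
  · filter_upwards [hae] with y ⟨j, hj, e⟩
    have hy := Ioo_subset_Icc_self (X.cell_subset j hj)
    have hnn : 0 ≤ (Ioo x (x + X.size)).indicator (fun _ => X.size ^ 2) y :=
      indicator_nonneg (fun _ _ => sq_nonneg _) y
    split_ifs at e with hxa
    · rw [green_of_le hx.1 hx.2 (hxa.trans hj.1.le), e]
      simp only [Polynomial.eval_add, Polynomial.eval_mul, Polynomial.eval_C, Polynomial.eval_X]
      ring_nf
      exact hnn
    · simp only [Polynomial.eval_add, Polynomial.eval_mul, Polynomial.eval_C,
        Polynomial.eval_X] at e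
      rcases le_or_gt y x with hyx | hyx
      · rw [green_of_ge hx.1 hx.2 hyx, e]
        ring_nf
        exact hnn
      · have hlt : y - x ≤ X.size := by linarith [hj.2, X.length_le_size j, not_le.mp hxa]
        have hlt' : y < x + X.size := by linarith [hj.2, X.length_le_size j, not_le.mp hxa]
        rw [green_of_le hx.1 hx.2 hyx.le, e, indicator_of_mem (mem_Ioo.mpr ⟨hyx, hlt'⟩)]
        nlinarith
  · rw [integral_indicator measurableSet_Ioo, Measure.restrict_restrict measurableSet_Ioo,
      setIntegral_const, smul_eq_mul, pow_succ, mul_comm]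
    refine mul_le_mul_of_nonneg_left ?_ (sq_nonneg _)
    refine (measureReal_mono inter_subset_left (by simp)).trans ?_
    rw [Real.volume_real_Ioo_of_le (by linarith [X.size_pos])]
    linarith

theorem exists_approx_green {d : ℕ} (hd : d = 0 ∨ d = 1) (X : Mesh) {x : ℝ}
    (hx : x ∈ Icc (0 : ℝ) 1) :
    ∃ v ∈ piecewisePoly d X, ‖isKernel_green.section_ x - v‖ ^ 2 ≤ X.size ^ (d + 2) := by
  rcases hd with rfl | rfl
  · exact exists_approx_green_const X hx
  · exact exists_approx_green_affine X hx

/-- The orthogonal projection of `L²(D)` onto the closure of the piecewise polynomials of degree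
at most `d`. -/
def polyProj (d : ℕ) (X : Mesh) : L2D →L[ℝ] L2D :=
  (piecewisePoly d X).topologicalClosure.starProjection

theorem polyProj_symm (d : ℕ) (X : Mesh) (f g : L2D) :
    ⟪polyProj d X f, g⟫_ℝ = ⟪f, polyProj d X g⟫_ℝ :=
  Submodule.inner_starProjection_left_eq_right _ f g

theorem polyProj_idem (d : ℕ) (X : Mesh) (f : L2D) :
    polyProj d X (polyProj d X f) = polyProj d X f :=
  Submodule.starProjection_eq_self_iff.mpr (Submodule.starProjection_apply_mem _ f)

theorem polyProj_of_mem {d : ℕ} {X : Mesh} {v : L2D} (hv : v ∈ piecewisePoly d X) :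
    polyProj d X v = v :=
  Submodule.starProjection_eq_self_iff.mpr (Submodule.le_topologicalClosure _ hv)

theorem polyProj_eq_zero {d : ℕ} {X : Mesh} {f : L2D}
    (h : ∀ v ∈ piecewisePoly d X, ⟪f, v⟫_ℝ = 0) : polyProj d X f = 0 := by
  rw [polyProj, Submodule.starProjection_apply_eq_zero_iff, Submodule.orthogonal_closure]
  exact (Submodule.mem_orthogonal' _ _).mpr h

theorem norm_sub_polyProj_le {d : ℕ} {X : Mesh} {v : L2D} (hv : v ∈ piecewisePoly d X) (f : L2D) :
    ‖f - polyProj d X f‖ ≤ ‖f - v‖ := by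
  rw [polyProj, Submodule.starProjection_minimal]
  exact ciInf_le (f := fun w : (piecewisePoly d X).topologicalClosure => ‖f - w‖)
    ⟨0, by rintro _ ⟨w, rfl⟩; exact norm_nonneg _⟩ ⟨v, Submodule.le_topologicalClosure _ hv⟩

/-- A Hilbert–Schmidt estimate for `G(1 - Π)`: as `(G(1 - Π)ε_i)(x)` is the `i`-th Fourier
coefficient of `(1 - Π)g(x, ·)`, Bessel's inequality reduces it to the approximation of Green's
function. -/
theorem sum_norm_sq_greenOp_sub_polyProj_le {d : ℕ} (hd : d = 0 ∨ d = 1) (X : Mesh) (K : ℕ) :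
    ∑ i ∈ Finset.Icc 1 K, ‖greenOp (epsL2 i - polyProj d X (epsL2 i))‖ ^ 2
      ≤ X.size ^ (d + 2) := by
  have h1 : ∀ i, ‖greenOp (epsL2 i - polyProj d X (epsL2 i))‖ ^ 2 = ∫ x,
      ⟪isKernel_green.section_ x, epsL2 i - polyProj d X (epsL2 i)⟫_ℝ ^ 2 ∂measD := fun i => by
    rw [L2D.norm_sq_eq]
    refine integral_congr_ae ?_
    filter_upwards [coeFn_greenOp (epsL2 i - polyProj d X (epsL2 i))] with x hx
    rw [hx]
  have hint : ∀ i, Integrable (fun x =>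
      ⟪isKernel_green.section_ x, epsL2 i - polyProj d X (epsL2 i)⟫_ℝ ^ 2) measD := fun i =>
    (isKernel_green.memLp_integral _).integrable_sq
  simp_rw [h1]
  rw [← integral_finsetSum _ fun i _ => hint i]
  have hbound : ∀ x ∈ Icc (0 : ℝ) 1, ∑ i ∈ Finset.Icc 1 K,
      ⟪isKernel_green.section_ x, epsL2 i - polyProj d X (epsL2 i)⟫_ℝ ^ 2 ≤ X.size ^ (d + 2) := by
    intro x hx
    obtain ⟨v, hv, hle⟩ := exists_approx_green hd X hx
    set s := isKernel_green.section_ x with hs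
    have e : ∀ i, ⟪s, epsL2 i - polyProj d X (epsL2 i)⟫_ℝ = ⟪epsL2 i, s - polyProj d X s⟫_ℝ :=
      fun i => by
        rw [inner_sub_right, inner_sub_right, ← polyProj_symm, real_inner_comm,
          real_inner_comm (epsL2 i)]
    simp_rw [e]
    have hB := orthonormal_epsL2.sum_inner_products_le (s - polyProj d X s)
      (s := (Finset.Icc 1 K).subtype fun i => 1 ≤ i)
    have hsum : ∑ i ∈ Finset.Icc 1 K, ⟪epsL2 i, s - polyProj d X s⟫_ℝ ^ 2
        = ∑ i ∈ (Finset.Icc 1 K).subtype fun i => 1 ≤ i,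
          ‖⟪epsL2 i, s - polyProj d X s⟫_ℝ‖ ^ 2 := by
      rw [Finset.sum_subtype_of_mem (fun i => ‖⟪epsL2 i, s - polyProj d X s⟫_ℝ‖ ^ 2)
        fun i hi => (Finset.mem_Icc.mp hi).1]
      exact Finset.sum_congr rfl fun i _ => by rw [Real.norm_eq_abs, sq_abs]
    rw [hsum]
    refine hB.trans (le_trans ?_ hle)
    exact pow_le_pow_left₀ (norm_nonneg _) (norm_sub_polyProj_le hv s) 2
  refine (integral_mono_ae (integrable_finsetSum _ fun i _ => hint i)
    (integrable_const (X.size ^ (d + 2))) ?_).trans (by simp)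
  filter_upwards [ae_restrict_mem measurableSet_Ioo] with x hx
    using hbound x (Ioo_subset_Icc_self hx)

/-! ### The Crank–Nicolson method for a positive bounded operator -/

section Abstract

variable {H : Type*} [NormedAddCommGroup H] [InnerProductSpace ℝ H]

/-- A bounded operator `B` that is symmetric and positive semidefinite. -/
structure IsSymmPos (B : H →L[ℝ] H) : Prop where
  symm : ∀ x y, ⟪B x, y⟫_ℝ = ⟪x, B y⟫_ℝ
  nonneg : ∀ x, 0 ≤ ⟪B x, x⟫_ℝ

/-- The discrete energy estimate, obtained by testing with the midpoint values
`(e j + e (j + 1)) / 2`. -/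
theorem IsSymmPos.sum_norm_sq_midpoint_le {B : H →L[ℝ] H} (hB : IsSymmPos B) {δ : ℝ} (hδ : 0 < δ)
    (e ρ : ℕ → H)
    (h : ∀ j, B (e (j + 1) - e j) + δ • ((1 / 2 : ℝ) • (e j + e (j + 1))) = δ • ρ j) (m : ℕ) :
    δ * ∑ j ∈ Finset.range m, ‖(1 / 2 : ℝ) • (e j + e (j + 1))‖ ^ 2
      ≤ ⟪B (e 0), e 0⟫_ℝ + δ * ∑ j ∈ Finset.range m, ‖ρ j‖ ^ 2 := by
  suffices hs : ⟪B (e m), e m⟫_ℝ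
      + δ * ∑ j ∈ Finset.range m, ‖(1 / 2 : ℝ) • (e j + e (j + 1))‖ ^ 2
      ≤ ⟪B (e 0), e 0⟫_ℝ + δ * ∑ j ∈ Finset.range m, ‖ρ j‖ ^ 2 by
    linarith [hB.nonneg (e m)]
  induction m with
  | zero => simp
  | succ m ih =>
    rw [Finset.sum_range_succ, Finset.sum_range_succ]
    set v := (1 / 2 : ℝ) • (e m + e (m + 1)) with hv
    have h1 : ⟪B (e (m + 1)), e (m + 1)⟫_ℝ - ⟪B (e m), e m⟫_ℝ
        = ⟪B (e (m + 1) - e m), (2 : ℝ) • v⟫_ℝ := by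
      have h2 : (2 : ℝ) • v = e m + e (m + 1) := by rw [hv, smul_smul]; norm_num
      rw [h2, map_sub, inner_sub_left, inner_add_right, inner_add_right,
        hB.symm (e (m + 1)) (e m), real_inner_comm (B (e m)) (e (m + 1))]
      ring
    rw [eq_sub_of_add_eq (h m), real_inner_smul_right, inner_sub_left, real_inner_smul_left,
      real_inner_smul_left, real_inner_self_eq_norm_sq] at h1
    have h3 := norm_sub_sq_real (ρ m) v
    nlinarith [sq_nonneg ‖ρ m - v‖, mul_nonneg hδ.le (sq_nonneg ‖ρ m - v‖)]

variable [CompleteSpace H]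

theorem IsSymmPos.isUnit_add {B : H →L[ℝ] H} (hB : IsSymmPos B) {c : ℝ} (hc : 0 < c) :
    IsUnit (B + c • (1 : H →L[ℝ] H)) := by
  refine ContinuousLinearMap.isUnit_of_forall_le_norm_inner_map _ (c := ⟨c, hc.le⟩) hc fun x => ?_
  have h : ⟪(B + c • (1 : H →L[ℝ] H)) x, x⟫_ℝ = ⟪B x, x⟫_ℝ + c * ‖x‖ ^ 2 := by
    simp [inner_add_left, real_inner_smul_left]
  rw [h, Real.norm_of_nonneg (add_nonneg (hB.nonneg x) (by positivity))]
  change ‖x‖ ^ 2 * c ≤ _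
  linarith [hB.nonneg x]

/-- The operator `(B + δ/2)⁻¹`. -/
def cnInv (B : H →L[ℝ] H) (δ : ℝ) : H →L[ℝ] H := Ring.inverse (B + (δ / 2) • 1)

/-- The Crank–Nicolson propagator `(B + δ/2)⁻¹ (B - δ/2)` over a time step `δ`, for the evolution
equation `B u' + u = 0`. -/
def cnStep (B : H →L[ℝ] H) (δ : ℝ) : H →L[ℝ] H := cnInv B δ * (B - (δ / 2) • 1)

/-- The operator that maps a unit impulse of load to its contribution to the Crank–Nicolson
approximation after `j` further steps. -/
def cnImpulse (B : H →L[ℝ] H) (δ : ℝ) (j : ℕ) : H →L[ℝ] H := cnStep B δ ^ j * (cnInv B δ * B)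

namespace IsSymmPos

variable {B : H →L[ℝ] H} {δ : ℝ}

theorem cnInv_eq_iff (hB : IsSymmPos B) (hδ : 0 < δ) {x y : H} :
    cnInv B δ y = x ↔ B x + (δ / 2) • x = y := by
  have hu := hB.isUnit_add (half_pos hδ)
  constructor
  · rintro rfl
    exact congrArg (fun S : H →L[ℝ] H => S y) (Ring.mul_inverse_cancel _ hu)
  · rintro rfl
    exact congrArg (fun S : H →L[ℝ] H => S x) (Ring.inverse_mul_cancel _ hu)

theorem cnStep_spec (hB : IsSymmPos B) (hδ : 0 < δ) (x : H) :
    B (cnStep B δ x) + (δ / 2) • cnStep B δ x = B x - (δ / 2) • x :=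
  (hB.cnInv_eq_iff hδ).mp rfl

theorem midpoint_cnStep (hB : IsSymmPos B) (hδ : 0 < δ) (x : H) (j : ℕ) :
    (1 / 2 : ℝ) • ((cnStep B δ ^ j) x + (cnStep B δ ^ (j + 1)) x) = cnImpulse B δ j x := by
  have h : cnInv B δ (B x) = (1 / 2 : ℝ) • (x + cnStep B δ x) := by
    rw [hB.cnInv_eq_iff hδ, map_smul, map_add]
    have := hB.cnStep_spec hδ x
    rw [← eq_sub_iff_add_eq] at this
    rw [this]
    module
  rw [cnImpulse, mul_apply_eq_comp, mul_apply_eq_comp, h, map_smul,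
    map_add, pow_succ, mul_apply_eq_comp]

theorem cnStep_pow_succ (hB : IsSymmPos B) (hδ : 0 < δ) (x : H) (j : ℕ) :
    B ((cnStep B δ ^ (j + 1)) x - (cnStep B δ ^ j) x)
      + δ • ((1 / 2 : ℝ) • ((cnStep B δ ^ j) x + (cnStep B δ ^ (j + 1)) x)) = 0 := by
  have h := hB.cnStep_spec hδ ((cnStep B δ ^ j) x)
  rw [pow_succ', mul_apply_eq_comp, map_sub]
  rw [← eq_sub_iff_add_eq] at h
  rw [h]
  module

/-- The discrete Duhamel formula. -/
theorem crankNicolson_eq_sum (hB : IsSymmPos B) (hδ : 0 < δ) {M : ℕ} {U F : ℕ → H} (h0 : U 0 = 0)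
    (h : ∀ m < M, B (U (m + 1) - U m) + (δ / 2) • (U (m + 1) + U m) = B (F m)) :
    ∀ m ≤ M, U m = ∑ l ∈ Finset.range m, cnImpulse B δ (m - 1 - l) (F l) := by
  intro m hm
  induction m with
  | zero => simpa using h0
  | succ m ih =>
    have h1 : U (m + 1) = cnStep B δ (U m) + cnInv B δ (B (F m)) := by
      have h2 := h m hm
      have h3 : cnInv B δ (B (U m) - (δ / 2) • U m + B (F m)) = U (m + 1) := by
        rw [hB.cnInv_eq_iff hδ, ← h2, map_sub]
        module
      rw [← h3, map_add]
      rfl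
    rw [h1, ih (by lia), Finset.sum_range_succ, map_sum]
    congr 1
    · refine Finset.sum_congr rfl fun l hl => ?_
      have hl := Finset.mem_range.mp hl
      rw [show m + 1 - 1 - l = (m - 1 - l) + 1 by lia, cnImpulse, cnImpulse, pow_succ', mul_assoc]
      rfl
    · rw [Nat.add_sub_cancel, Nat.sub_self, cnImpulse, pow_zero, one_mul]
      rfl

end IsSymmPos

/-- The midpoint values of the Crank–Nicolson approximations of `μ y' + y = 0`, `y(0) = 1`. -/
def cnScalar (μ δ : ℝ) (j : ℕ) : ℝ :=
  (((μ - δ / 2) / (μ + δ / 2)) ^ j + ((μ - δ / 2) / (μ + δ / 2)) ^ (j + 1)) / 2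

theorem cnScalar_eq {μ δ : ℝ} (hμ : 0 < μ) (hδ : 0 < δ) (j : ℕ) :
    μ * (((μ - δ / 2) / (μ + δ / 2)) ^ (j + 1) - ((μ - δ / 2) / (μ + δ / 2)) ^ j)
      + δ * cnScalar μ δ j = 0 := by
  have : μ + δ / 2 ≠ 0 := by positivity
  have h : μ * ((μ - δ / 2) / (μ + δ / 2) - 1) + δ * ((1 + (μ - δ / 2) / (μ + δ / 2)) / 2) = 0 := by
    field_simp
    ring
  rw [cnScalar, pow_succ]
  linear_combination ((μ - δ / 2) / (μ + δ / 2)) ^ j * h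

theorem isSymmPos_smul_one {μ : ℝ} (hμ : 0 ≤ μ) : IsSymmPos (μ • (1 : ℝ →L[ℝ] ℝ)) where
  symm x y := by simp; ring
  nonneg x := by
    simp only [smul_apply, one_apply_eq_self, smul_eq_mul,
      RCLike.inner_apply, conj_trivial]
    nlinarith [mul_nonneg hμ (sq_nonneg x)]

/-- The scalar case of the discrete energy estimate. -/
theorem sum_sq_midpoint_le {μ δ : ℝ} (hμ : 0 ≤ μ) (hδ : 0 < δ) (e ρ : ℕ → ℝ)
    (h : ∀ j, μ * (e (j + 1) - e j) + δ * ((e j + e (j + 1)) / 2) = δ * ρ j) (m : ℕ) :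
    δ * ∑ j ∈ Finset.range m, ((e j + e (j + 1)) / 2) ^ 2
      ≤ μ * e 0 ^ 2 + δ * ∑ j ∈ Finset.range m, ρ j ^ 2 := by
  have key := (isSymmPos_smul_one hμ).sum_norm_sq_midpoint_le hδ e ρ (fun j => by
    simp only [smul_apply, one_apply_eq_self, smul_eq_mul]
    linarith [h j]) m
  simp only [smul_apply, one_apply_eq_self, smul_eq_mul,
    RCLike.inner_apply, conj_trivial, Real.norm_eq_abs, sq_abs] at key
  have e1 : ∀ j, (e j + e (j + 1)) / 2 = 1 / 2 * (e j + e (j + 1)) := fun j => by ring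
  simp_rw [e1]
  linarith

theorem sum_cnScalar_sq_le {μ δ : ℝ} (hμ : 0 < μ) (hδ : 0 < δ) (m : ℕ) :
    δ * ∑ j ∈ Finset.range m, cnScalar μ δ j ^ 2 ≤ μ := by
  have h := sum_sq_midpoint_le hμ.le hδ (fun j => ((μ - δ / 2) / (μ + δ / 2)) ^ j) (fun _ => 0)
    (fun j => by rw [mul_zero]; exact cnScalar_eq hμ hδ j) m
  simpa [cnScalar] using h

/-- Replacing the operator by another one changes the Crank–Nicolson midpoint values of an
eigenvector by an amount controlled, in the `ℓ²` norm in time, by the consistency error at that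
eigenvector. -/
theorem IsSymmPos.sum_norm_sq_cnImpulse_sub_le {B : H →L[ℝ] H} (hB : IsSymmPos B) {μ δ : ℝ}
    (hμ : 0 < μ) (hδ : 0 < δ) (x : H) (m : ℕ) :
    δ * ∑ j ∈ Finset.range m, ‖cnImpulse B δ j x - cnScalar μ δ j • x‖ ^ 2
      ≤ μ⁻¹ * ‖B x - μ • x‖ ^ 2 := by
  set r := (μ - δ / 2) / (μ + δ / 2) with hr
  have hmid : ∀ j, (1 / 2 : ℝ) • (((cnStep B δ ^ j) x - r ^ j • x)
      + ((cnStep B δ ^ (j + 1)) x - r ^ (j + 1) • x))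
      = cnImpulse B δ j x - cnScalar μ δ j • x := fun j => by
    rw [← hB.midpoint_cnStep hδ, cnScalar, ← hr]
    module
  have h := hB.sum_norm_sq_midpoint_le hδ (fun j => (cnStep B δ ^ j) x - r ^ j • x)
    (fun j => (cnScalar μ δ j / μ) • (B x - μ • x)) (fun j => by
      have e1 := hB.cnStep_pow_succ hδ x j
      rw [hB.midpoint_cnStep hδ, ← eq_neg_iff_add_eq_zero] at e1
      have e2 : r ^ (j + 1) - r ^ j = -(δ * (cnScalar μ δ j / μ)) := by
        rw [eq_neg_iff_add_eq_zero]
        field_simp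
        linarith [cnScalar_eq hμ hδ j]
      have e3 : (cnStep B δ ^ (j + 1)) x - r ^ (j + 1) • x - ((cnStep B δ ^ j) x - r ^ j • x)
          = ((cnStep B δ ^ (j + 1)) x - (cnStep B δ ^ j) x) - (r ^ (j + 1) - r ^ j) • x := by
        module
      have e4 : cnScalar μ δ j = cnScalar μ δ j / μ * μ := by field_simp
      rw [hmid, e3, map_sub, e1, map_smul, e2]
      generalize cnScalar μ δ j / μ = w at e4 ⊢
      rw [e4]
      module) m
  simp only [hmid, pow_zero, one_apply_eq_self, one_smul, sub_self, inner_zero_right,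
    zero_add, norm_smul, mul_pow, Real.norm_eq_abs, sq_abs, div_pow] at h
  refine h.trans ?_
  rw [← Finset.sum_mul, ← Finset.sum_div, ← mul_assoc, ← mul_div_assoc]
  refine mul_le_mul_of_nonneg_right ?_ (sq_nonneg _)
  rw [div_le_iff₀ (by positivity)]
  calc _ ≤ μ := sum_cnScalar_sq_le hμ hδ m
    _ = μ⁻¹ * μ ^ 2 := by field_simp

end Abstract

/-! ### The error of the Crank–Nicolson method for a scalar equation -/

section Scalar

variable {μ δ : ℝ}

theorem sum_integral_cnScalar_sub_exp_sq_le_const (hμ : 0 < μ) (hδ : 0 < δ) (m : ℕ) :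
    ∑ j ∈ Finset.range m, ∫ t in (j * δ)..((j + 1 : ℕ) * δ),
      (cnScalar μ δ j - Real.exp (-t / μ)) ^ 2 ≤ 3 * μ := by
  have h1 : ∀ j ∈ Finset.range m, ∫ t in (j * δ)..((j + 1 : ℕ) * δ),
      (cnScalar μ δ j - Real.exp (-t / μ)) ^ 2
      ≤ 2 * (δ * cnScalar μ δ j ^ 2) + 2 * ∫ t in (j * δ)..((j + 1 : ℕ) * δ),
        Real.exp (-t / μ) ^ 2 := fun j _ => by
    have hle : (j * δ : ℝ) ≤ (j + 1 : ℕ) * δ := by push_cast; linarith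
    have e : 2 * (δ * cnScalar μ δ j ^ 2) = ∫ t in (j * δ)..((j + 1 : ℕ) * δ),
        2 * cnScalar μ δ j ^ 2 := by
      rw [intervalIntegral.integral_const, smul_eq_mul]
      push_cast
      ring
    rw [e, ← intervalIntegral.integral_const_mul, ← intervalIntegral.integral_add
      (by simp) (by apply Continuous.intervalIntegrable; fun_prop)]
    refine intervalIntegral.integral_mono_on hle (by apply Continuous.intervalIntegrable; fun_prop)
      (by apply Continuous.intervalIntegrable; fun_prop) fun t _ => ?_
    nlinarith [sq_nonneg (cnScalar μ δ j + Real.exp (-t / μ))]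
  refine (Finset.sum_le_sum h1).trans ?_
  rw [Finset.sum_add_distrib, ← Finset.mul_sum, ← Finset.mul_sum, ← Finset.mul_sum,
    intervalIntegral.sum_integral_adjacent_intervals (a := fun j : ℕ => (j * δ : ℝ)) fun j _ => by
      apply Continuous.intervalIntegrable; fun_prop]
  have h2 : ∫ t in ((0 : ℕ) * δ)..(m * δ), Real.exp (-t / μ) ^ 2
      = -(μ / 2) * Real.exp (-(m * δ) / μ) ^ 2
        - (-(μ / 2) * Real.exp (-((0 : ℕ) * δ) / μ) ^ 2) := by
    refine intervalIntegral.integral_eq_sub_of_hasDerivAt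
      (f := fun t => -(μ / 2) * Real.exp (-t / μ) ^ 2) (fun t _ => ?_)
      (by apply Continuous.intervalIntegrable; fun_prop)
    refine (((((hasDerivAt_id' t).neg.div_const μ).exp).pow 2).const_mul (-(μ / 2))).congr_deriv ?_
    field_simp
    norm_num
    rw [neg_div]
    ring
  rw [h2]
  simp only [Nat.cast_zero, zero_mul, neg_zero, zero_div, Real.exp_zero]
  nlinarith [sum_cnScalar_sq_le hμ hδ m, mul_nonneg hμ.le (sq_nonneg (Real.exp (-(m * δ) / μ)))]

theorem sum_integral_cnScalar_sub_exp_sq_le_sq (hμ : 0 < μ) (hδ : 0 < δ) (m : ℕ) :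
    ∑ j ∈ Finset.range m, ∫ t in (j * δ)..((j + 1 : ℕ) * δ),
      (cnScalar μ δ j - Real.exp (-t / μ)) ^ 2 ≤ 4 * μ * (δ / μ) ^ 2 := by
  set r := (μ - δ / 2) / (μ + δ / 2) with hr
  set y : ℕ → ℝ := fun j => Real.exp (-(j * δ) / μ) with hy
  set z := δ / μ with hz
  have hzpos : 0 < z := div_pos hδ hμ
  have hyz : ∀ j, y (j + 1) = y j * Real.exp (-z) := fun j => by
    simp only [hy, hz]
    rw [← Real.exp_add]
    congr 1
    push_cast
    field_simp
    ring
  have hypos : ∀ j, 0 < y j := fun j => Real.exp_pos _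
  have hz1 : 1 - Real.exp (-z) ≤ z := by linarith [Real.add_one_le_exp (-z)]
  have hz2 : z * Real.exp (-z) ≤ 1 - Real.exp (-z) := by
    have h1 := Real.add_one_le_exp z
    have h2 : Real.exp z * Real.exp (-z) = 1 := by rw [← Real.exp_add]; simp
    nlinarith [Real.exp_pos (-z)]
  have hydec : ∀ j, y (j + 1) ≤ y j := fun j => by
    rw [hyz]
    exact mul_le_of_le_one_right (hypos j).le (Real.exp_le_one_iff.mpr (by linarith))
  have hyle : ∀ j, y j ≤ 1 := fun j => Real.exp_le_one_iff.mpr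
    (div_nonpos_of_nonpos_of_nonneg (neg_nonpos.mpr (by positivity)) hμ.le)
  -- the quadrature error of the trapezoidal rule
  set ρ : ℕ → ℝ := fun j => (y j - y (j + 1)) / z - (y j + y (j + 1)) / 2 with hρ
  have hρle : ∀ j, ρ j ^ 2 ≤ (y j - y (j + 1)) ^ 2 := fun j => by
    have h1 : (y j - y (j + 1)) / z ≤ y j := by
      rw [div_le_iff₀ hzpos, hyz]
      nlinarith [hypos j]
    have h2 : y (j + 1) ≤ (y j - y (j + 1)) / z := by
      rw [le_div_iff₀ hzpos, hyz]
      nlinarith [hypos j]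
    refine sq_le_sq' ?_ ?_ <;> simp only [hρ] <;> linarith [hydec j]
  have henergy := sum_sq_midpoint_le hμ.le hδ (fun j => r ^ j - y j) ρ (fun j => by
    have h1 := cnScalar_eq hμ hδ j
    rw [cnScalar, ← hr] at h1
    have h2 : δ * ((y j - y (j + 1)) / z) = μ * (y j - y (j + 1)) := by
      rw [hz]; field_simp
    simp only [hρ]
    linear_combination h1 - h2) m
  have hy0 : r ^ 0 - y 0 = 0 := by simp [hy]
  rw [hy0] at henergy
  have h1 : ∀ j ∈ Finset.range m, ∫ t in (j * δ)..((j + 1 : ℕ) * δ),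
      (cnScalar μ δ j - Real.exp (-t / μ)) ^ 2
      ≤ 2 * (δ * (((r ^ j - y j) + (r ^ (j + 1) - y (j + 1))) / 2) ^ 2)
        + 2 * δ * (y j - y (j + 1)) ^ 2 := fun j _ => by
    have hle : (j * δ : ℝ) ≤ (j + 1 : ℕ) * δ := by push_cast; linarith
    have e : 2 * (δ * (((r ^ j - y j) + (r ^ (j + 1) - y (j + 1))) / 2) ^ 2)
        + 2 * δ * (y j - y (j + 1)) ^ 2 = ∫ t in (j * δ)..((j + 1 : ℕ) * δ),
        (2 * (((r ^ j - y j) + (r ^ (j + 1) - y (j + 1))) / 2) ^ 2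
          + 2 * (y j - y (j + 1)) ^ 2) := by
      rw [intervalIntegral.integral_const, smul_eq_mul]
      push_cast
      ring
    rw [e]
    refine intervalIntegral.integral_mono_on hle (by apply Continuous.intervalIntegrable; fun_prop)
      (by simp) fun t ht => ?_
    have ht1 : Real.exp (-t / μ) ≤ y j := Real.exp_le_exp.mpr
      (div_le_div_of_nonneg_right (by linarith [ht.1]) hμ.le)
    have ht2 : y (j + 1) ≤ Real.exp (-t / μ) := Real.exp_le_exp.mpr
      (div_le_div_of_nonneg_right (by linarith [ht.2]) hμ.le)
    have ht3 : ((y j + y (j + 1)) / 2 - Real.exp (-t / μ)) ^ 2 ≤ (y j - y (j + 1)) ^ 2 :=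
      sq_le_sq' (by linarith [hydec j]) (by linarith [hydec j])
    have ht4 : cnScalar μ δ j - Real.exp (-t / μ)
        = ((r ^ j - y j) + (r ^ (j + 1) - y (j + 1))) / 2
          + ((y j + y (j + 1)) / 2 - Real.exp (-t / μ)) := by
      rw [cnScalar, ← hr]; ring
    rw [ht4]
    nlinarith [sq_nonneg (((r ^ j - y j) + (r ^ (j + 1) - y (j + 1))) / 2
          - ((y j + y (j + 1)) / 2 - Real.exp (-t / μ)))]
  have hsum : ∑ j ∈ Finset.range m, (y j - y (j + 1)) ^ 2 ≤ z := by
    have h2 : ∀ j ∈ Finset.range m, (y j - y (j + 1)) ^ 2 ≤ z * (y j - y (j + 1)) := fun j _ => by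
      rw [sq]
      refine mul_le_mul_of_nonneg_right ?_ (sub_nonneg.mpr (hydec j))
      rw [hyz]
      nlinarith [hypos j, hyle j, mul_nonneg hzpos.le (sub_nonneg.mpr (hyle j))]
    refine (Finset.sum_le_sum h2).trans ?_
    rw [← Finset.mul_sum, Finset.sum_range_sub']
    have : y 0 - y m ≤ 1 := by linarith [hyle 0, hypos m]
    exact mul_le_of_le_one_right hzpos.le this
  refine (Finset.sum_le_sum h1).trans ?_
  rw [Finset.sum_add_distrib, ← Finset.mul_sum, ← Finset.mul_sum, ← Finset.mul_sum]
  have h3 := mul_le_mul_of_nonneg_left (Finset.sum_le_sum fun j (_ : j ∈ Finset.range m) => hρle j)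
    hδ.le
  have h4 : 4 * μ * z ^ 2 = 4 * δ * z := by rw [hz]; field_simp
  rw [h4]
  nlinarith [mul_le_mul_of_nonneg_left hsum hδ.le]

/-- The bound is the interpolation between the stability bound `O(μ)` and the second order bound
`O(μ (δ/μ)²)`. -/
theorem sum_integral_cnScalar_sub_exp_sq_le (hμ : 0 < μ) (hδ : 0 < δ) (m : ℕ) {a : ℝ}
    (ha0 : 0 ≤ a) (ha2 : a ≤ 2) :
    ∑ j ∈ Finset.range m, ∫ t in (j * δ)..((j + 1 : ℕ) * δ),
      (cnScalar μ δ j - Real.exp (-t / μ)) ^ 2 ≤ 4 * μ * (δ / μ) ^ a := by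
  have hz : 0 < δ / μ := div_pos hδ hμ
  rcases le_total (δ / μ) 1 with h | h
  · refine (sum_integral_cnScalar_sub_exp_sq_le_sq hμ hδ m).trans ?_
    refine mul_le_mul_of_nonneg_left ?_ (by positivity)
    rw [← Real.rpow_natCast]
    exact Real.rpow_le_rpow_of_exponent_ge hz h (by exact_mod_cast ha2)
  · refine (sum_integral_cnScalar_sub_exp_sq_le_const hμ hδ m).trans ?_
    have := Real.one_le_rpow h ha0
    nlinarith

end Scalar

/-! ### The continuous problem: uniqueness and Duhamel's formula -/

/-- Uniqueness for `G² w' + w = 0`, `w(0) = 0` in integrated form: the energy `‖G ∫₀ᵗ w‖²` is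
nonincreasing. -/
theorem eq_zero_of_add_integral_eq_zero {H : Type*} [NormedAddCommGroup H] [InnerProductSpace ℝ H]
    [CompleteSpace H] {G : H →L[ℝ] H} (hG : ∀ x y, ⟪G x, y⟫_ℝ = ⟪x, G y⟫_ℝ)
    (hinj : Function.Injective G) {T : ℝ} (hT : 0 ≤ T) {w : ℝ → H}
    (hw : ContinuousOn w (Icc 0 T))
    (h : ∀ t ∈ Icc 0 T, G (G (w t)) + ∫ s in (0 : ℝ)..t, w s = 0) : ∀ t ∈ Icc 0 T, w t = 0 := by
  set Z : ℝ → H := fun t => ∫ s in (0 : ℝ)..t, w s with hZ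
  have hwi : IntervalIntegrable w volume 0 T :=
    (hw.mono (by rw [uIcc_of_le hT])).intervalIntegrable
  have hZc : ContinuousOn Z (Icc 0 T) := by
    have := intervalIntegral.continuousOn_primitive_interval (μ := volume) (f := w)
      (a := 0) (b := T)
      (by rw [uIcc_of_le hT]; exact hw.integrableOn_Icc)
    rwa [uIcc_of_le hT] at this
  have hZd : ∀ t ∈ Ioo 0 T, HasDerivAt Z (w t) t := fun t ht => by
    have hnhds : Icc 0 T ∈ nhds t := Icc_mem_nhds ht.1 ht.2
    refine intervalIntegral.integral_hasDerivAt_right ?_ ?_ (hw.continuousAt hnhds)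
    · exact hwi.mono_set (by
        rw [uIcc_of_le hT, uIcc_of_le ht.1.le]; exact Icc_subset_Icc_right ht.2.le)
    · exact (hw.mono Ioo_subset_Icc_self).stronglyMeasurableAtFilter isOpen_Ioo t ht
  have hφd : ∀ t ∈ Ioo 0 T, HasDerivAt (fun t => ‖G (Z t)‖ ^ 2) (-(2 * ‖Z t‖ ^ 2)) t :=
    fun t ht => by
      have h1 := (G.hasFDerivAt.comp_hasDerivAt t (hZd t ht)).norm_sq
      refine h1.congr_deriv ?_
      have h2 := eq_neg_of_add_eq_zero_left (h t (Ioo_subset_Icc_self ht))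
      simp only [Function.comp]
      rw [hG, h2, inner_neg_right, real_inner_self_eq_norm_sq]
      ring
  have hanti : AntitoneOn (fun t => ‖G (Z t)‖ ^ 2) (Icc 0 T) := by
    refine antitoneOn_of_deriv_nonpos (convex_Icc 0 T)
      ((G.continuous.comp_continuousOn hZc).norm.pow 2) ?_ ?_
    · rw [interior_Icc]
      exact fun t ht => (hφd t ht).differentiableAt.differentiableWithinAt
    · rw [interior_Icc]
      intro t ht
      rw [(hφd t ht).deriv]
      linarith [sq_nonneg ‖Z t‖]
  intro t ht
  have h0 := hanti (left_mem_Icc.mpr hT) ht ht.1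
  have hZ0 : Z 0 = 0 := by simp [hZ]
  simp only [hZ0, map_zero, norm_zero] at h0
  have h1 : G (Z t) = 0 := by
    have : ‖G (Z t)‖ ^ 2 = 0 := le_antisymm (by simpa using h0) (sq_nonneg _)
    exact norm_eq_zero.mp (pow_eq_zero_iff two_ne_zero |>.mp this)
  have h2 : Z t = 0 := hinj (by rw [h1, map_zero])
  have h3 := h t ht
  change G (G (w t)) + Z t = 0 at h3
  rw [h2, add_zero] at h3
  exact hinj (hinj (by rw [h3, map_zero, map_zero]))

/-- A scalar load for which the fundamental theorem of calculus is available: measurable, locally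
integrable and continuous outside a countable set. -/
structure IsLoad (f : ℝ → ℝ) : Prop where
  meas : Measurable f
  integrable : ∀ a b, IntervalIntegrable f volume a b
  continuousAt : ∃ s : Set ℝ, s.Countable ∧ ∀ x ∉ s, ContinuousAt f x

/-- Duhamel's integral: the solution of `μ c' + c = μ f`, `c(0) = 0`. -/
def duhamel (μ : ℝ) (f : ℝ → ℝ) (t : ℝ) : ℝ := ∫ s in (0 : ℝ)..t, f s * Real.exp (-(t - s) / μ)

namespace IsLoad

variable {f : ℝ → ℝ} {μ : ℝ}

theorem integrable_mul (hf : IsLoad f) {g : ℝ → ℝ} (hg : Continuous g) (a b : ℝ) :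
    IntervalIntegrable (fun s => f s * g s) volume a b :=
  (hf.integrable a b).mul_continuousOn hg.continuousOn

theorem duhamel_eq (t : ℝ) :
    duhamel μ f t = Real.exp (-t / μ) * ∫ s in (0 : ℝ)..t, f s * Real.exp (s / μ) := by
  rw [duhamel, ← intervalIntegral.integral_const_mul]
  refine intervalIntegral.integral_congr fun s _ => ?_
  have : Real.exp (-(t - s) / μ) = Real.exp (-t / μ) * Real.exp (s / μ) := by
    rw [← Real.exp_add]
    congr 1
    ring
  rw [this]
  ring

theorem continuous_duhamel (hf : IsLoad f) : Continuous (duhamel μ f) := by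
  have h : duhamel μ f
      = fun t => Real.exp (-t / μ) * ∫ s in (0 : ℝ)..t, f s * Real.exp (s / μ) :=
    funext duhamel_eq
  rw [h]
  exact (by fun_prop : Continuous fun t : ℝ => Real.exp (-t / μ)).mul
    (intervalIntegral.continuous_primitive
      (fun a b => hf.integrable_mul (by fun_prop) a b) 0)

theorem duhamel_spec (hf : IsLoad f) (hμ : 0 < μ) (t : ℝ) :
    μ * duhamel μ f t + ∫ s in (0 : ℝ)..t, duhamel μ f s = μ * ∫ s in (0 : ℝ)..t, f s := by
  obtain ⟨S, hS, hc⟩ := hf.continuousAt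
  have hd : ∀ x ∉ S, HasDerivAt (duhamel μ f) (f x - duhamel μ f x / μ) x := fun x hx => by
    have hexp : Continuous fun s : ℝ => Real.exp (s / μ) := by fun_prop
    have h1 : HasDerivAt (fun t => ∫ s in (0 : ℝ)..t, f s * Real.exp (s / μ))
        (f x * Real.exp (x / μ)) x :=
      intervalIntegral.integral_hasDerivAt_right (hf.integrable_mul hexp 0 x)
        ((hf.meas.mul hexp.measurable).stronglyMeasurable.stronglyMeasurableAtFilter)
        ((hc x hx).mul hexp.continuousAt)
    have h2 := (((hasDerivAt_id' x).neg.div_const μ).exp).mul h1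
    have h3 : duhamel μ f
        = fun t => Real.exp (-t / μ) * ∫ s in (0 : ℝ)..t, f s * Real.exp (s / μ) :=
      funext duhamel_eq
    rw [h3]
    refine h2.congr_deriv ?_
    have h4 : Real.exp (-x / μ) * Real.exp (x / μ) = 1 := by
      rw [← Real.exp_add, neg_div, neg_add_cancel, Real.exp_zero]
    linear_combination f x * h4
  have hci : IntervalIntegrable (fun s => duhamel μ f s / μ) volume 0 t :=
    (hf.continuous_duhamel.div_const μ).intervalIntegrable _ _
  have hftc := MeasureTheory.integral_eq_of_hasDerivAt_off_countable (duhamel μ f)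
    (fun x => f x - duhamel μ f x / μ) (a := 0) (b := t) hS hf.continuous_duhamel.continuousOn
    (fun x hx => hd x hx.2) ((hf.integrable 0 t).sub hci)
  have h0 : duhamel μ f 0 = 0 := by simp [duhamel]
  rw [intervalIntegral.integral_sub (hf.integrable 0 t) hci, intervalIntegral.integral_div,
    h0, sub_zero] at hftc
  rw [← hftc]
  field_simp
  ring

end IsLoad

/-- The eigenvalue `λ_i⁻⁴` of `G²` at `ε_i`. -/
def eig (i : ℕ) : ℝ := (((i * Real.pi) ^ 2)⁻¹) ^ 2

theorem eig_pos {i : ℕ} (hi : 1 ≤ i) : 0 < eig i := by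
  unfold eig
  positivity

theorem greenOp_greenOp_epsL2 {i : ℕ} (hi : 1 ≤ i) :
    greenOp (greenOp (epsL2 i)) = eig i • epsL2 i := by
  rw [greenOp_epsL2 hi, map_smul, greenOp_epsL2 hi, smul_smul, eig, ← sq]

section Loads

variable {K : ℕ} {g : ℕ → ℝ → ℝ}

theorem integral_inner_load (hg : ∀ i, IsLoad (g i)) (a b : ℝ) (χ : L2D) :
    ∫ s in a..b, ⟪∑ i ∈ Finset.Icc 1 K, g i s • epsL2 i, χ⟫_ℝ
      = ⟪∑ i ∈ Finset.Icc 1 K, (∫ s in a..b, g i s) • epsL2 i, χ⟫_ℝ := by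
  simp_rw [sum_inner, real_inner_smul_left]
  rw [intervalIntegral.integral_finsetSum fun i _ => ((hg i).integrable a b).mul_const _]
  simp_rw [intervalIntegral.integral_mul_const]

/-- The variational solution is given by Duhamel's formula. -/
theorem IsSolution.eq_duhamel {T : ℝ} (hT : 0 ≤ T) (hg : ∀ i, IsLoad (g i)) {u : ℝ → L2D}
    (hu : IsSolution T (fun s => ∑ i ∈ Finset.Icc 1 K, g i s • epsL2 i) u) :
    ∀ t ∈ Icc 0 T, u t = ∑ i ∈ Finset.Icc 1 K, duhamel (eig i) (g i) t • epsL2 i := by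
  set w₀ : ℝ → L2D := fun t => ∑ i ∈ Finset.Icc 1 K, duhamel (eig i) (g i) t • epsL2 i with hw₀
  have hw₀c : Continuous w₀ := continuous_finsetSum _ fun i _ =>
    ((hg i).continuous_duhamel).smul continuous_const
  have hui : ∀ t ∈ Icc 0 T, IntervalIntegrable u volume 0 t := fun t ht =>
    (hu.continuousOn.mono (by
      rw [uIcc_of_le ht.1]; exact Icc_subset_Icc_right ht.2)).intervalIntegrable
  -- testing with `G² η` turns the variational formulation into an equation in `L²(D)`
  have heq : ∀ t ∈ Icc 0 T, greenOp (greenOp (u t)) + ∫ s in (0 : ℝ)..t, u s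
      = ∑ i ∈ Finset.Icc 1 K, (eig i * ∫ s in (0 : ℝ)..t, g i s) • epsL2 i := by
    intro t ht
    refine ext_inner_right ℝ fun η => ?_
    have h1 := hu.equation t ht _ (greenOp_mem_H2H10 (greenOp η))
    have h2 : ∫ s in (0 : ℝ)..t, bform (u s) (greenOp (greenOp η))
        = ⟪∫ s in (0 : ℝ)..t, u s, η⟫_ℝ := by
      have e1 : ∫ s in (0 : ℝ)..t, ⟪η, u s⟫_ℝ = ⟪η, ∫ s in (0 : ℝ)..t, u s⟫_ℝ :=
        (innerSL ℝ η).intervalIntegral_comp_comm (hui t ht)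
      rw [real_inner_comm, ← e1, ← setIntegral_Ioo_eq ht.1, ← setIntegral_Ioo_eq ht.1]
      refine integral_congr_ae ?_
      filter_upwards [ae_restrict_of_ae_restrict_of_subset (Ioo_subset_Ioo_right ht.2) hu.mem]
        with s hs
      obtain ⟨v, hv⟩ := mem_H2H10_iff.mp hs
      rw [← hv, bform_greenOp, ← greenOp_symm, real_inner_comm]
    rw [h2, integral_inner_load hg, ← greenOp_symm, ← greenOp_symm, ← greenOp_symm,
      ← greenOp_symm, ← inner_add_left, map_sum, map_sum] at h1
    rw [h1]
    congr 1
    refine Finset.sum_congr rfl fun i hi => ?_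
    rw [map_smul, map_smul, greenOp_greenOp_epsL2 (Finset.mem_Icc.mp hi).1, smul_smul, mul_comm]
  have heq₀ : ∀ t, greenOp (greenOp (w₀ t)) + ∫ s in (0 : ℝ)..t, w₀ s
      = ∑ i ∈ Finset.Icc 1 K, (eig i * ∫ s in (0 : ℝ)..t, g i s) • epsL2 i := by
    intro t
    simp only [hw₀]
    have hi : ∀ i ∈ Finset.Icc 1 K,
        IntervalIntegrable (fun s => duhamel (eig i) (g i) s • epsL2 i) volume 0 t := fun i _ =>
      (((hg i).continuous_duhamel).smul continuous_const).intervalIntegrable _ _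
    rw [intervalIntegral.integral_finsetSum hi, map_sum, map_sum, ← Finset.sum_add_distrib]
    refine Finset.sum_congr rfl fun i hi => ?_
    have hi1 := (Finset.mem_Icc.mp hi).1
    rw [map_smul, map_smul, greenOp_greenOp_epsL2 hi1, intervalIntegral.integral_smul_const,
      smul_smul, ← add_smul, ← (hg i).duhamel_spec (eig_pos hi1) t, mul_comm]
  intro t ht
  refine sub_eq_zero.mp (eq_zero_of_add_integral_eq_zero greenOp_symm greenOp_injective hT
    (w := fun t => u t - w₀ t) (hu.continuousOn.sub hw₀c.continuousOn) (fun t ht => ?_) t ht)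
  rw [intervalIntegral.integral_sub (hui t ht) (hw₀c.intervalIntegrable _ _), map_sub, map_sub,
    sub_add_sub_comm, heq t ht, heq₀ t, sub_self]

/-- The discrete solution operator `G Π G` of the biharmonic problem. -/
def discOp (d : ℕ) (X : Mesh) : L2D →L[ℝ] L2D := greenOp.comp ((polyProj d X).comp greenOp)

theorem discOp_apply (d : ℕ) (X : Mesh) (f : L2D) :
    discOp d X f = greenOp (polyProj d X (greenOp f)) := rfl

theorem isSymmPos_discOp (d : ℕ) (X : Mesh) : IsSymmPos (discOp d X) where
  symm x y := by
    rw [discOp_apply, discOp_apply, greenOp_symm, polyProj_symm, greenOp_symm]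
  nonneg x := by
    rw [discOp_apply, greenOp_symm, ← polyProj_idem, polyProj_symm]
    exact real_inner_self_nonneg

theorem timeInterval_succ (δ : ℝ) (l : ℕ) :
    timeInterval δ (l + 1) = Ioo (l * δ) ((l + 1 : ℕ) * δ) := by
  rw [timeInterval]
  push_cast
  rw [add_sub_cancel_right]

/-- The fully discrete approximations are the Crank–Nicolson approximations for the bounded
operator `G Π G`. -/
theorem IsCrankNicolsonFE.eq_sum {d : ℕ} {X : Mesh} {T : ℝ} (hT : 0 < T) {M : ℕ} (hM : 1 ≤ M)
    (hg : ∀ i, IsLoad (g i)) {U : ℕ → L2D}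
    (hU : IsCrankNicolsonFE (d + 2) X T M (fun s => ∑ i ∈ Finset.Icc 1 K, g i s • epsL2 i) U) :
    ∀ m ≤ M, U m = ∑ l ∈ Finset.range m, cnImpulse (discOp d X) (T / M) (m - 1 - l)
      (∑ i ∈ Finset.Icc 1 K, (∫ s in (l * (T / M))..((l + 1 : ℕ) * (T / M)), g i s) • epsL2 i) := by
  have hM' : (0 : ℝ) < M := by exact_mod_cast hM
  have hδ : 0 < T / M := div_pos hT hM'
  set δ : ℝ := T / M with hδdef
  have hmem : ∀ m ≤ M, ∃ v ∈ piecewisePoly d X, greenOp v = U m := fun m hm => by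
    rcases Nat.eq_zero_or_pos m with rfl | h
    · exact ⟨0, Submodule.zero_mem _, by rw [map_zero, hU.initial]⟩
    · exact mem_feSpace_iff.mp (hU.mem m (Finset.mem_Icc.mpr ⟨h, hm⟩))
  refine (isSymmPos_discOp d X).crankNicolson_eq_sum hδ hU.initial fun m hm => ?_
  obtain ⟨v, hv, hvU⟩ := hmem (m + 1) hm
  obtain ⟨v', hv', hvU'⟩ := hmem m hm.le
  set F : L2D := ∑ i ∈ Finset.Icc 1 K, (∫ s in (m * δ)..((m + 1 : ℕ) * δ), g i s) • epsL2 i with hF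
  have hle : (m * δ : ℝ) ≤ (m + 1 : ℕ) * δ := by push_cast; linarith
  -- testing with `G q` for piecewise polynomials `q` determines the projection of the residual
  have hzero : polyProj d X (greenOp (U (m + 1) - U m) + (δ / 2) • (v + v') - greenOp F) = 0 := by
    refine polyProj_eq_zero fun q hq => ?_
    have h1 := hU.step (m + 1) (Finset.mem_Icc.mpr ⟨by lia, hm⟩) _
      (mem_feSpace_iff.mpr ⟨q, hq, rfl⟩)
    rw [Nat.add_sub_cancel, ← hδdef, timeInterval_succ, setIntegral_Ioo_eq hle,
      integral_inner_load hg, ← hvU, ← hvU', ← map_add, bform_greenOp, hvU, hvU', ← hF,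
      ← greenOp_symm, ← greenOp_symm] at h1
    rw [inner_sub_left, inner_add_left, real_inner_smul_left, h1, sub_self]
  have hp : polyProj d X (v + v') = v + v' := polyProj_of_mem (Submodule.add_mem _ hv hv')
  rw [map_sub, map_add, map_smul, hp, sub_eq_zero] at hzero
  rw [discOp_apply, discOp_apply, ← hzero, map_add, map_smul, map_add, hvU, hvU']

end Loads

/-! ### Piecewise constant loads and the representation of the error -/

theorem measurableSet_timeInterval (δ : ℝ) (n : ℕ) : MeasurableSet (timeInterval δ n) :=
  measurableSet_Ioo

theorem disjoint_timeInterval {δ : ℝ} (hδ : 0 < δ) {n n' : ℕ} (h : n ≠ n') :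
    Disjoint (timeInterval δ n) (timeInterval δ n') := by
  wlog hlt : n < n' generalizing n n'
  · exact (this h.symm (lt_of_le_of_ne (not_lt.mp hlt) h.symm)).symm
  refine Set.disjoint_left.mpr fun s hs hs' => ?_
  have h1 : (n : ℝ) + 1 ≤ n' := by exact_mod_cast hlt
  have h2 : (n : ℝ) * δ ≤ (n' - 1) * δ := mul_le_mul_of_nonneg_right (by linarith) hδ.le
  linarith [hs.2, hs'.1]

theorem volume_real_timeInterval {δ : ℝ} (hδ : 0 < δ) (n : ℕ) :
    volume.real (timeInterval δ n) = δ := by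
  rw [timeInterval, Real.volume_real_Ioo_of_le (by nlinarith)]
  ring

theorem integrable_indicator_timeInterval (δ : ℝ) (n : ℕ) :
    Integrable ((timeInterval δ n).indicator (1 : ℝ → ℝ)) :=
  (integrable_indicator_iff measurableSet_Ioo).mpr (integrableOn_const (by simp))

/-- The piecewise constant function with value `a n` on `((n-1)δ, nδ)` for `n = 1, …, N`. -/
def stepLoad (δ : ℝ) (N : ℕ) (a : ℕ → ℝ) (s : ℝ) : ℝ :=
  ∑ n ∈ Finset.Icc 1 N, a n * (timeInterval δ n).indicator 1 s

theorem isLoad_stepLoad (δ : ℝ) (N : ℕ) (a : ℕ → ℝ) : IsLoad (stepLoad δ N a) where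
  meas := Finset.measurable_sum _ fun n _ =>
    (measurable_one.indicator (measurableSet_timeInterval δ n)).const_mul _
  integrable x y := by
    have h : ∀ n ∈ Finset.Icc 1 N, Integrable fun s => a n * (timeInterval δ n).indicator 1 s :=
      fun n _ => (integrable_indicator_timeInterval δ n).const_mul _
    exact (integrable_finsetSum _ h).intervalIntegrable
  continuousAt := by
    refine ⟨⋃ n : ℕ, {((n : ℝ) - 1) * δ, n * δ}, countable_iUnion fun n => by simp, fun x hx => ?_⟩
    simp only [mem_iUnion, mem_insert_iff, mem_singleton_iff, not_exists, not_or] at hx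
    refine tendsto_finsetSum _ fun n _ => ContinuousAt.const_mul ?_ (a n)
    by_cases hxn : x ∈ timeInterval δ n
    · refine (continuousAt_const (y := (1 : ℝ))).congr ?_
      filter_upwards [isOpen_Ioo.mem_nhds hxn] with s hs
      exact (indicator_of_mem (f := 1) hs).symm
    · have hx' : x ∈ (Icc (((n : ℝ) - 1) * δ) (n * δ))ᶜ := fun h' =>
        hxn ⟨lt_of_le_of_ne h'.1 (Ne.symm (hx n).1), lt_of_le_of_ne h'.2 (hx n).2⟩
      refine (continuousAt_const (y := (0 : ℝ))).congr ?_
      filter_upwards [isClosed_Icc.isOpen_compl.mem_nhds hx'] with s hs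
      exact (indicator_of_notMem (fun h' => hs (Ioo_subset_Icc_self h')) _).symm

section Hilbert

variable {H : Type*} [NormedAddCommGroup H] [InnerProductSpace ℝ H]

theorem intervalIntegrable_indicator {E : Type*} [NormedAddCommGroup E] {κ : ℝ → E}
    (hκ : Continuous κ) (δ : ℝ) (n : ℕ) (a b : ℝ) :
    IntervalIntegrable ((timeInterval δ n).indicator κ) volume a b := by
  rw [intervalIntegrable_iff]
  exact (intervalIntegrable_iff.mp (hκ.intervalIntegrable a b)).indicator
    (measurableSet_timeInterval δ n)

theorem sum_integral_indicator_one_le {Δ δ : ℝ} (hΔ : 0 < Δ) (hδ : 0 < δ) (n m : ℕ) :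
    ∑ l ∈ Finset.range m, ∫ s in (l * δ)..((l + 1 : ℕ) * δ),
      (timeInterval Δ n).indicator (1 : ℝ → ℝ) s ≤ Δ := by
  rw [intervalIntegral.sum_integral_adjacent_intervals (a := fun l : ℕ => (l * δ : ℝ)) fun l _ =>
      (integrable_indicator_timeInterval Δ n).intervalIntegrable,
    intervalIntegral.integral_of_le (by simp; positivity)]
  refine (setIntegral_le_integral (integrable_indicator_timeInterval Δ n)
    (Filter.Eventually.of_forall fun s => indicator_nonneg (fun _ _ => zero_le_one) s)).trans ?_
  rw [integral_indicator (measurableSet_timeInterval Δ n)]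
  simp only [Pi.one_apply, setIntegral_const, smul_eq_mul, mul_one]
  exact (volume_real_timeInterval hΔ n).le

/-- Bessel's inequality in time: the indicators of the intervals `((n-1)Δ, nΔ)` are orthogonal, of
squared norm `Δ`. -/
theorem sum_norm_sq_integral_indicator_le [CompleteSpace H] {Δ δ : ℝ} (hΔ : 0 < Δ) (hδ : 0 < δ)
    {κ : ℕ → ℝ → H} (hκ : ∀ l, Continuous (κ l)) (N m : ℕ) :
    ∑ n ∈ Finset.Icc 1 N, ‖∑ l ∈ Finset.range m, ∫ s in (l * δ)..((l + 1 : ℕ) * δ),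
        (timeInterval Δ n).indicator (κ l) s‖ ^ 2
      ≤ Δ * ∑ l ∈ Finset.range m, ∫ s in (l * δ)..((l + 1 : ℕ) * δ), ‖κ l s‖ ^ 2 := by
  have hle : ∀ l : ℕ, (l * δ : ℝ) ≤ (l + 1 : ℕ) * δ := fun l => by push_cast; linarith
  have hκn : ∀ l, Continuous fun s => ‖κ l s‖ ^ 2 := fun l => (hκ l).norm.pow 2
  have h1 : ∀ n ∈ Finset.Icc 1 N, ‖∑ l ∈ Finset.range m, ∫ s in (l * δ)..((l + 1 : ℕ) * δ),
      (timeInterval Δ n).indicator (κ l) s‖ ^ 2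
      ≤ Δ * ∑ l ∈ Finset.range m, ∫ s in (l * δ)..((l + 1 : ℕ) * δ),
        (timeInterval Δ n).indicator (fun s => ‖κ l s‖ ^ 2) s := fun n _ => by
    set v := ∑ l ∈ Finset.range m, ∫ s in (l * δ)..((l + 1 : ℕ) * δ),
      (timeInterval Δ n).indicator (κ l) s with hv
    have e1 : 2 * ‖v‖ ^ 2 = ∑ l ∈ Finset.range m, ∫ s in (l * δ)..((l + 1 : ℕ) * δ),
        (timeInterval Δ n).indicator (fun s => 2 * ⟪v, κ l s⟫_ℝ) s := by
      rw [← real_inner_self_eq_norm_sq]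
      nth_rewrite 2 [hv]
      rw [inner_sum, Finset.mul_sum]
      refine Finset.sum_congr rfl fun l _ => ?_
      have e2 := (innerSL ℝ v).intervalIntegral_comp_comm
        (intervalIntegrable_indicator (hκ l) Δ n (l * δ) ((l + 1 : ℕ) * δ))
      simp only [innerSL_apply_apply] at e2
      rw [← e2, ← intervalIntegral.integral_const_mul]
      refine intervalIntegral.integral_congr fun s _ => ?_
      by_cases hs : s ∈ timeInterval Δ n <;> simp [hs]
    have e3 : ∀ l ∈ Finset.range m, ∫ s in (l * δ)..((l + 1 : ℕ) * δ),
        (timeInterval Δ n).indicator (fun s => 2 * ⟪v, κ l s⟫_ℝ) s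
        ≤ Δ * (∫ s in (l * δ)..((l + 1 : ℕ) * δ),
            (timeInterval Δ n).indicator (fun s => ‖κ l s‖ ^ 2) s)
          + Δ⁻¹ * ‖v‖ ^ 2 * ∫ s in (l * δ)..((l + 1 : ℕ) * δ),
            (timeInterval Δ n).indicator (1 : ℝ → ℝ) s := fun l _ => by
      have i1 := (intervalIntegrable_indicator (hκn l) Δ n (l * δ) ((l + 1 : ℕ) * δ)).const_mul Δ
      have i2 := (intervalIntegrable_indicator (κ := (1 : ℝ → ℝ)) continuous_one Δ n (l * δ)
        ((l + 1 : ℕ) * δ)).const_mul (Δ⁻¹ * ‖v‖ ^ 2)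
      rw [← intervalIntegral.integral_const_mul, ← intervalIntegral.integral_const_mul,
        ← intervalIntegral.integral_add i1 i2]
      refine intervalIntegral.integral_mono_on (hle l)
        (intervalIntegrable_indicator
          (continuous_const.mul (continuous_const.inner (hκ l))) Δ n _ _) (i1.add i2)
        fun s _ => ?_
      by_cases hs : s ∈ timeInterval Δ n
      · simp only [indicator_of_mem hs, Pi.one_apply, mul_one]
        have e4 : (0 : ℝ) ≤ Δ * (‖κ l s‖ - Δ⁻¹ * ‖v‖) ^ 2 := by positivity
        have e5 : Δ * (‖κ l s‖ - Δ⁻¹ * ‖v‖) ^ 2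
            = Δ * ‖κ l s‖ ^ 2 - 2 * (‖v‖ * ‖κ l s‖) + Δ⁻¹ * ‖v‖ ^ 2 := by
          field_simp
          ring
        linarith [real_inner_le_norm v (κ l s)]
      · simp [hs]
    have e6 := e1.le.trans (Finset.sum_le_sum e3)
    rw [Finset.sum_add_distrib, ← Finset.mul_sum, ← Finset.mul_sum] at e6
    have e7 : Δ⁻¹ * ‖v‖ ^ 2 * ∑ l ∈ Finset.range m, ∫ s in (l * δ)..((l + 1 : ℕ) * δ),
        (timeInterval Δ n).indicator (1 : ℝ → ℝ) s ≤ ‖v‖ ^ 2 := by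
      refine (mul_le_mul_of_nonneg_left (sum_integral_indicator_one_le hΔ hδ n m)
        (by positivity)).trans (le_of_eq ?_)
      field_simp
    linarith
  refine (Finset.sum_le_sum h1).trans ?_
  rw [← Finset.mul_sum, Finset.sum_comm]
  refine mul_le_mul_of_nonneg_left (Finset.sum_le_sum fun l _ => ?_) hΔ.le
  rw [← intervalIntegral.integral_finsetSum fun n _ =>
    intervalIntegrable_indicator (hκn l) Δ n _ _]
  refine intervalIntegral.integral_mono_on (hle l) ?_ ((hκn l).intervalIntegrable _ _)
    fun s _ => ?_
  · have := IntervalIntegrable.sum (Finset.Icc 1 N) fun n _ =>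
      intervalIntegrable_indicator (hκn l) Δ n (l * δ) ((l + 1 : ℕ) * δ)
    rwa [Finset.sum_fn] at this
  · rw [← Finset.indicator_biUnion_apply (Finset.Icc 1 N) (timeInterval Δ)
      fun n _ n' _ hn => disjoint_timeInterval hΔ hn]
    exact indicator_le_self' (fun _ _ => sq_nonneg _) s

/-- The kernel of the error at time `mδ`: the difference, for a unit impulse of load `x` at time
`s ∈ (lδ, (l+1)δ)`, between the Crank–Nicolson approximation and the exact solution. -/
def errKernel (B : H →L[ℝ] H) (δ μ : ℝ) (x : H) (m l : ℕ) (s : ℝ) : H :=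
  cnImpulse B δ (m - 1 - l) x - Real.exp (-(m * δ - s) / μ) • x

theorem continuous_errKernel (B : H →L[ℝ] H) (δ μ : ℝ) (x : H) (m l : ℕ) :
    Continuous (errKernel B δ μ x m l) := by
  unfold errKernel
  fun_prop

/-- The error at time `mδ` for the load that is equal to `x` on the `n`-th interval of length `Δ`
and vanishes outside. -/
def errVec (B : H →L[ℝ] H) (Δ δ μ : ℝ) (x : H) (m n : ℕ) : H :=
  ∑ l ∈ Finset.range m, ∫ s in (l * δ)..((l + 1 : ℕ) * δ),
    (timeInterval Δ n).indicator (errKernel B δ μ x m l) s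

/-- The difference between the discrete and the continuous Duhamel formula for a piecewise constant
scalar load in the direction `x`. -/
theorem error_stepLoad [CompleteSpace H] (B : H →L[ℝ] H) (Δ δ μ : ℝ) (x : H) (m N : ℕ)
    (a : ℕ → ℝ) :
    ∑ l ∈ Finset.range m, (∫ s in (l * δ)..((l + 1 : ℕ) * δ), stepLoad Δ N a s) •
        cnImpulse B δ (m - 1 - l) x - duhamel μ (stepLoad Δ N a) (m * δ) • x
      = ∑ n ∈ Finset.Icc 1 N, a n • errVec B Δ δ μ x m n := by
  have hL := isLoad_stepLoad Δ N a
  have hexp : Continuous fun s : ℝ => Real.exp (-(m * δ - s) / μ) := by fun_prop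
  have h1 : duhamel μ (stepLoad Δ N a) (m * δ) = ∑ l ∈ Finset.range m,
      ∫ s in (l * δ)..((l + 1 : ℕ) * δ), stepLoad Δ N a s * Real.exp (-(m * δ - s) / μ) := by
    rw [intervalIntegral.sum_integral_adjacent_intervals (a := fun l : ℕ => (l * δ : ℝ))
      fun l _ => hL.integrable_mul hexp _ _, duhamel]
    simp
  rw [h1, Finset.sum_smul, ← Finset.sum_sub_distrib]
  simp_rw [errVec, Finset.smul_sum]
  rw [Finset.sum_comm]
  refine Finset.sum_congr rfl fun l _ => ?_
  rw [← intervalIntegral.integral_smul_const, ← intervalIntegral.integral_smul_const,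
    ← intervalIntegral.integral_sub]
  · simp_rw [← intervalIntegral.integral_smul]
    have hi : ∀ n ∈ Finset.Icc 1 N, IntervalIntegrable
        (fun s => a n • (timeInterval Δ n).indicator (errKernel B δ μ x m l) s) volume
        (l * δ) ((l + 1 : ℕ) * δ) := fun n _ =>
      (intervalIntegrable_indicator (continuous_errKernel B δ μ x m l) Δ n _ _).smul (a n)
    rw [← intervalIntegral.integral_finsetSum hi]
    refine intervalIntegral.integral_congr fun s _ => ?_
    simp only [stepLoad]
    rw [mul_smul, ← smul_sub, Finset.sum_smul]
    refine Finset.sum_congr rfl fun n _ => ?_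
    by_cases hs : s ∈ timeInterval Δ n <;> simp [hs, errKernel]
  · exact (hL.integrable _ _).smul_continuousOn continuousOn_const
  · exact (hL.integrable_mul hexp _ _).smul_continuousOn continuousOn_const

theorem sum_integral_norm_sq_errKernel_le [CompleteSpace H] {B : H →L[ℝ] H} (hB : IsSymmPos B)
    {δ μ : ℝ} (hμ : 0 < μ) (hδ : 0 < δ) {x : H} (hx : ‖x‖ = 1) (m : ℕ) {a : ℝ} (ha0 : 0 ≤ a)
    (ha2 : a ≤ 2) :
    ∑ l ∈ Finset.range m, ∫ s in (l * δ)..((l + 1 : ℕ) * δ), ‖errKernel B δ μ x m l s‖ ^ 2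
      ≤ 2 * (μ⁻¹ * ‖B x - μ • x‖ ^ 2) + 8 * μ * (δ / μ) ^ a := by
  -- reversal of time
  have h1 : ∑ l ∈ Finset.range m, ∫ s in (l * δ)..((l + 1 : ℕ) * δ),
      ‖errKernel B δ μ x m l s‖ ^ 2 = ∑ j ∈ Finset.range m, ∫ t in (j * δ)..((j + 1 : ℕ) * δ),
        ‖cnImpulse B δ j x - Real.exp (-t / μ) • x‖ ^ 2 := by
    rw [← Finset.sum_range_reflect]
    refine Finset.sum_congr rfl fun j hj => ?_
    have hj := Finset.mem_range.mp hj
    have hidx : m - 1 - (m - 1 - j) = j := by lia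
    simp_rw [errKernel, hidx]
    rw [intervalIntegral.integral_comp_sub_left
      (fun t => ‖cnImpulse B δ j x - Real.exp (-t / μ) • x‖ ^ 2) (m * δ)]
    have hc : ((m - 1 - j : ℕ) : ℝ) = m - 1 - j := by
      rw [Nat.sub_sub, Nat.cast_sub (by lia)]
      push_cast
      ring
    congr 1
    · push_cast
      rw [hc]
      ring
    · push_cast
      rw [hc]
      ring
  have h2 : ∀ j ∈ Finset.range m, ∫ t in (j * δ)..((j + 1 : ℕ) * δ),
      ‖cnImpulse B δ j x - Real.exp (-t / μ) • x‖ ^ 2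
      ≤ 2 * (δ * ‖cnImpulse B δ j x - cnScalar μ δ j • x‖ ^ 2)
        + 2 * ∫ t in (j * δ)..((j + 1 : ℕ) * δ),
          (cnScalar μ δ j - Real.exp (-t / μ)) ^ 2 := fun j _ => by
    have hle : (j * δ : ℝ) ≤ (j + 1 : ℕ) * δ := by push_cast; linarith
    have e : 2 * (δ * ‖cnImpulse B δ j x - cnScalar μ δ j • x‖ ^ 2)
        = ∫ t in (j * δ)..((j + 1 : ℕ) * δ),
          2 * ‖cnImpulse B δ j x - cnScalar μ δ j • x‖ ^ 2 := by
      rw [intervalIntegral.integral_const, smul_eq_mul]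
      push_cast
      ring
    rw [e, ← intervalIntegral.integral_const_mul, ← intervalIntegral.integral_add
      (by simp) (by apply Continuous.intervalIntegrable; fun_prop)]
    refine intervalIntegral.integral_mono_on hle (by apply Continuous.intervalIntegrable; fun_prop)
      (by apply Continuous.intervalIntegrable; fun_prop) fun t _ => ?_
    have e1 : cnImpulse B δ j x - Real.exp (-t / μ) • x
        = (cnImpulse B δ j x - cnScalar μ δ j • x)
          + (cnScalar μ δ j - Real.exp (-t / μ)) • x := by module
    have e2 : ‖(cnScalar μ δ j - Real.exp (-t / μ)) • x‖ ^ 2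
        = (cnScalar μ δ j - Real.exp (-t / μ)) ^ 2 := by
      rw [norm_smul, hx, mul_one, Real.norm_eq_abs, sq_abs]
    rw [e1, ← e2]
    have e3 := norm_add_le (cnImpulse B δ j x - cnScalar μ δ j • x)
      ((cnScalar μ δ j - Real.exp (-t / μ)) • x)
    refine (pow_le_pow_left₀ (norm_nonneg _) e3 2).trans ?_
    exact (add_sq_le).trans (le_of_eq (mul_add _ _ _))
  rw [h1]
  refine (Finset.sum_le_sum h2).trans ?_
  rw [Finset.sum_add_distrib, ← Finset.mul_sum, ← Finset.mul_sum, ← Finset.mul_sum]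
  linarith [hB.sum_norm_sq_cnImpulse_sub_le hμ hδ x m,
    sum_integral_cnScalar_sub_exp_sq_le hμ hδ m ha0 ha2]

end Hilbert

/-! ### Summation over the modes -/

theorem inv_eig_mul_norm_sq_discOp_sub {d : ℕ} {X : Mesh} {i : ℕ} (hi : 1 ≤ i) :
    (eig i)⁻¹ * ‖discOp d X (epsL2 i) - eig i • epsL2 i‖ ^ 2
      = ‖greenOp (epsL2 i - polyProj d X (epsL2 i))‖ ^ 2 := by
  have hpos := eig_pos hi
  have h : discOp d X (epsL2 i) - eig i • epsL2 i
      = -(((i * Real.pi) ^ 2)⁻¹ • greenOp (epsL2 i - polyProj d X (epsL2 i))) := by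
    rw [discOp_apply, ← greenOp_greenOp_epsL2 hi, greenOp_epsL2 hi, map_smul, map_smul, map_smul,
      map_sub]
    module
  rw [h, norm_neg, norm_smul, mul_pow, Real.norm_eq_abs, sq_abs, ← eig,
    inv_mul_cancel_left₀ hpos.ne']

theorem sum_rpow_neg_le {σ : ℝ} (hσ : 0 < σ) (K : ℕ) :
    ∑ i ∈ Finset.Icc 1 K, (i : ℝ) ^ (-(1 + σ)) ≤ 1 + 1 / σ := by
  rcases Nat.eq_zero_or_pos K with rfl | hK
  · simp; positivity
  suffices h : ∑ i ∈ Finset.Icc 1 K, (i : ℝ) ^ (-(1 + σ)) ≤ 1 + 1 / σ - (K : ℝ) ^ (-σ) / σ by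
    refine h.trans (sub_le_self _ (by positivity))
  induction K, hK using Nat.le_induction with
  | base => simp
  | succ n hn ih =>
    rw [Finset.sum_Icc_succ_top (by lia)]
    have hn0 : (0 : ℝ) < n := by exact_mod_cast hn
    set b : ℝ := ((n + 1 : ℕ) : ℝ) with hb
    have hbn : b = n + 1 := by rw [hb]; push_cast; rfl
    have hb0 : 0 < b := by rw [hbn]; positivity
    -- `n ^ (-σ) ≥ b ^ (-σ) (1 + σ / b)` with `b = n + 1`
    have h1 : b ^ (-σ) * (1 + σ / b) ≤ (n : ℝ) ^ (-σ) := by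
      have h2 : (n : ℝ) = b * (1 - 1 / b) := by rw [hbn]; field_simp; ring
      have h3 : 0 < 1 - 1 / b := by
        have : 0 < b * (1 - 1 / b) := h2 ▸ hn0
        exact pos_of_mul_pos_right this hb0.le
      rw [h2, Real.mul_rpow hb0.le h3.le]
      refine mul_le_mul_of_nonneg_left ?_ (by positivity)
      rw [Real.rpow_def_of_pos h3]
      have h4 : Real.log (1 - 1 / b) ≤ -(1 / b) := by
        linarith [Real.log_le_sub_one_of_pos h3]
      have h5 : σ / b ≤ Real.log (1 - 1 / b) * -σ := by
        have := mul_le_mul_of_nonneg_right h4 hσ.le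
        have h6 : σ / b = 1 / b * σ := by ring
        linarith
      linarith [Real.add_one_le_exp (Real.log (1 - 1 / b) * -σ)]
    have h7 : b ^ (-(1 + σ)) = b ^ (-σ) / b := by
      rw [neg_add', sub_eq_add_neg, add_comm, ← sub_eq_add_neg, Real.rpow_sub_one hb0.ne']
    have h8 : b ^ (-(1 + σ)) ≤ (n : ℝ) ^ (-σ) / σ - b ^ (-σ) / σ := by
      rw [h7, ← sub_div, le_div_iff₀ hσ]
      have : b ^ (-σ) * (1 + σ / b) = b ^ (-σ) + b ^ (-σ) / b * σ := by ring
      linarith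
    linarith

theorem eig_mul_rpow_le {i : ℕ} (hi : 1 ≤ i) {δ ε : ℝ} (hδ : 0 < δ) (hε : 0 < ε) :
    eig i * (δ / eig i) ^ (3 / 4 - 2 * ε) ≤ δ ^ (3 / 4 - 2 * ε) * (i : ℝ) ^ (-(1 + 8 * ε)) := by
  have hpos := eig_pos hi
  have hi0 : (0 : ℝ) < i := by exact_mod_cast hi
  have h1 : eig i * (δ / eig i) ^ (3 / 4 - 2 * ε)
      = δ ^ (3 / 4 - 2 * ε) * (eig i) ^ (1 / 4 + 2 * ε) := by
    rw [Real.div_rpow hδ.le hpos.le, show (1 / 4 + 2 * ε : ℝ) = 1 - (3 / 4 - 2 * ε) by ring,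
      Real.rpow_sub hpos 1, Real.rpow_one]
    ring
  have h2 : eig i ≤ (i : ℝ) ^ (-4 : ℝ) := by
    rw [eig, Real.rpow_neg hi0.le, inv_pow, ← pow_mul]
    rw [show (4 : ℝ) = ((2 * 2 : ℕ) : ℝ) by norm_num, Real.rpow_natCast]
    refine inv_anti₀ (by positivity) (pow_le_pow_left₀ hi0.le ?_ _)
    exact le_mul_of_one_le_right hi0.le (by linarith [Real.pi_gt_three])
  rw [h1]
  refine mul_le_mul_of_nonneg_left ?_ (by positivity)
  refine (Real.rpow_le_rpow hpos.le h2 (by positivity)).trans (le_of_eq ?_)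
  rw [← Real.rpow_mul hi0.le]
  congr 1
  ring

/-! ### The mean square error -/

section Cell

variable {T : ℝ} {N n n' i i' : ℕ}

theorem inner_toLp_cell (δ : ℝ) : ⟪(memLp_cell T δ n i).toLp (cell δ n i),
      (memLp_cell T δ n' i').toLp (cell δ n' i')⟫_ℝ
    = (∫ t in Ioo 0 T, (timeInterval δ n).indicator (1 : ℝ → ℝ) t
        * (timeInterval δ n').indicator (1 : ℝ → ℝ) t) * ⟪epsL2 i, epsL2 i'⟫_ℝ := by
  have h1 : ⟪epsL2 i, epsL2 i'⟫_ℝ = ∫ x in Ioo (0 : ℝ) 1, eps i x * eps i' x := by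
    rw [L2D.inner_eq]
    refine integral_congr_ae ?_
    filter_upwards [(memLp_eps i).coeFn_toLp, (memLp_eps i').coeFn_toLp] with x h1 h2
    rw [epsL2, epsL2, h1, h2]
  rw [h1, ← setIntegral_prod_mul, ← Measure.volume_eq_prod, L2.inner_def]
  refine integral_congr_ae ?_
  filter_upwards [(memLp_cell T δ n i).coeFn_toLp, (memLp_cell T δ n' i').coeFn_toLp] with z h2 h3
  rw [h2, h3, cell, cell]
  simp only [RCLike.inner_apply, conj_trivial]
  ring

theorem timeInterval_subset (hT : 0 < T) (hn : n ∈ Finset.Icc 1 N) :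
    timeInterval (T / N) n ⊆ Ioo 0 T := by
  obtain ⟨h1, h2⟩ := Finset.mem_Icc.mp hn
  have hN : (0 : ℝ) < N := by exact_mod_cast h1.trans h2
  have h1' : (1 : ℝ) ≤ n := by exact_mod_cast h1
  have h2' : (n : ℝ) ≤ N := by exact_mod_cast h2
  have hδ : 0 < T / N := div_pos hT hN
  refine Ioo_subset_Ioo (mul_nonneg (by linarith) hδ.le) ?_
  calc (n : ℝ) * (T / N) ≤ N * (T / N) := mul_le_mul_of_nonneg_right h2' hδ.le
    _ = T := by field_simp

theorem inner_toLp_cell_self (hT : 0 < T) (hn : n ∈ Finset.Icc 1 N) (hi : 1 ≤ i) :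
    ⟪(memLp_cell T (T / N) n i).toLp (cell (T / N) n i),
      (memLp_cell T (T / N) n i).toLp (cell (T / N) n i)⟫_ℝ = T / N := by
  obtain ⟨h1, h2⟩ := Finset.mem_Icc.mp hn
  have hN : (0 : ℝ) < N := by exact_mod_cast h1.trans h2
  rw [inner_toLp_cell, real_inner_self_eq_norm_sq, norm_epsL2 hi, one_pow, mul_one]
  simp_rw [← Set.inter_indicator_mul, Set.inter_self, Pi.one_apply, mul_one]
  rw [setIntegral_indicator (measurableSet_timeInterval _ _),
    inter_eq_self_of_subset_right (timeInterval_subset hT hn), setIntegral_const, smul_eq_mul,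
    mul_one, volume_real_timeInterval (div_pos hT hN)]

theorem inner_toLp_cell_of_ne (hT : 0 < T) (hn : n ∈ Finset.Icc 1 N) (hi : 1 ≤ i) (hi' : 1 ≤ i')
    (hne : (n, i) ≠ (n', i')) :
    ⟪(memLp_cell T (T / N) n i).toLp (cell (T / N) n i),
      (memLp_cell T (T / N) n' i').toLp (cell (T / N) n' i')⟫_ℝ = 0 := by
  obtain ⟨h1, h2⟩ := Finset.mem_Icc.mp hn
  have hN : (0 : ℝ) < N := by exact_mod_cast h1.trans h2
  rw [inner_toLp_cell]
  by_cases hii : i = i'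
  · have hnn : n ≠ n' := fun h => hne (by rw [h, hii])
    simp_rw [← Set.inter_indicator_mul]
    rw [(disjoint_timeInterval (div_pos hT hN) hnn).inter_eq]
    simp
  · rw [inner_epsL2_of_ne hi hi' hii, mul_zero]

end Cell

/-- The second moment of a combination of fixed vectors with uncorrelated coefficients of equal
second moment. -/
theorem integral_norm_sq_sum {Ω : Type*} [MeasurableSpace Ω] {P : Measure Ω} {H ι : Type*}
    [NormedAddCommGroup H] [InnerProductSpace ℝ H] [DecidableEq ι]
    {R : ι → Ω → ℝ} {S : Finset ι} {Δ : ℝ}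
    (hR : ∀ a ∈ S, MemLp (R a) 2 P)
    (hcov : ∀ a ∈ S, ∀ b ∈ S, ∫ ω, R a ω * R b ω ∂P = if a = b then Δ else 0) (k : ι → H) :
    Integrable (fun ω => ‖∑ a ∈ S, R a ω • k a‖ ^ 2) P ∧
      ∫ ω, ‖∑ a ∈ S, R a ω • k a‖ ^ 2 ∂P = Δ * ∑ a ∈ S, ‖k a‖ ^ 2 := by
  have h1 : ∀ ω, ‖∑ a ∈ S, R a ω • k a‖ ^ 2
      = ∑ a ∈ S, ∑ b ∈ S, R a ω * R b ω * ⟪k a, k b⟫_ℝ := fun ω => by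
    rw [← real_inner_self_eq_norm_sq]
    simp_rw [sum_inner, inner_sum, real_inner_smul_left, real_inner_smul_right, mul_assoc]
  have hint : ∀ a ∈ S, ∀ b ∈ S, Integrable (fun ω => R a ω * R b ω * ⟪k a, k b⟫_ℝ) P :=
    fun a ha b hb => ((hR a ha).integrable_mul (hR b hb)).mul_const _
  simp_rw [h1]
  refine ⟨integrable_finsetSum _ fun a ha => integrable_finsetSum _ fun b hb => hint a ha b hb, ?_⟩
  rw [integral_finsetSum _ fun a ha => integrable_finsetSum _ fun b hb => hint a ha b hb,
    Finset.mul_sum]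
  refine Finset.sum_congr rfl fun a ha => ?_
  rw [integral_finsetSum _ fun b hb => hint a ha b hb]
  simp_rw [integral_mul_const]
  rw [Finset.sum_eq_single a]
  · rw [hcov a ha a ha, if_pos rfl, real_inner_self_eq_norm_sq]
  · intro b hb hba
    rw [hcov a ha b hb, if_neg hba.symm, zero_mul]
  · exact fun h => absurd ha h

section Main

variable {d : ℕ} {X : Mesh} {T : ℝ} {K N M : ℕ}

theorem spectralNoise_eq {Ω : Type*} (W : Lp ℝ 2 (measTD T) → Ω → ℝ) (ω : Ω) :
    spectralNoise T K N W ω = fun s => ∑ i ∈ Finset.Icc 1 K,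
      stepLoad (T / N) N (fun n => (T / N)⁻¹ * increment T N W n i ω) s • epsL2 i := by
  funext s
  simp_rw [spectralNoise, stepLoad, Finset.sum_smul]
  rw [Finset.sum_comm]
  refine Finset.sum_congr rfl fun n _ => ?_
  by_cases hs : s ∈ timeInterval (T / N) n
  · simp only [indicator_of_mem hs, Pi.one_apply, mul_one, Finset.smul_sum, smul_smul]
  · simp [hs]

/-- Pathwise, the error is a linear combination, with deterministic vectors, of the increments of
the noise. -/
theorem error_eq_sum (hT : 0 < T) (hM : 1 ≤ M) {Ω : Type*} {W : Lp ℝ 2 (measTD T) → Ω → ℝ} {ω : Ω}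
    {u : ℝ → L2D} {U : ℕ → L2D} (hu : IsSolution T (spectralNoise T K N W ω) u)
    (hU : IsCrankNicolsonFE (d + 2) X T M (spectralNoise T K N W ω) U) {m : ℕ} (hm : m ≤ M) :
    U m - u (m * (T / M)) = ∑ a ∈ Finset.Icc 1 N ×ˢ Finset.Icc 1 K,
      increment T N W a.1 a.2 ω • ((T / N : ℝ)⁻¹ •
        errVec (discOp d X) (T / N) (T / M) (eig a.2) (epsL2 a.2) m a.1) := by
  have hM' : (0 : ℝ) < M := by exact_mod_cast hM
  have hm' : (m : ℝ) ≤ M := by exact_mod_cast hm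
  rw [spectralNoise_eq] at hu hU
  have hg : ∀ i, IsLoad (stepLoad (T / N) N fun n => (T / N)⁻¹ * increment T N W n i ω) :=
    fun i => isLoad_stepLoad _ _ _
  have ht : m * (T / M) ∈ Icc 0 T := by
    refine ⟨by positivity, ?_⟩
    calc m * (T / M) ≤ M * (T / M) := mul_le_mul_of_nonneg_right hm' (by positivity)
      _ = T := by field_simp
  rw [hU.eq_sum hT hM hg m hm, hu.eq_duhamel hT.le hg _ ht, Finset.sum_product_right]
  simp_rw [map_sum, map_smul]
  rw [Finset.sum_comm, ← Finset.sum_sub_distrib]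
  refine Finset.sum_congr rfl fun i _ => ?_
  rw [error_stepLoad]
  refine Finset.sum_congr rfl fun n _ => ?_
  simp only [smul_smul]
  rw [mul_comm]

/-- The mean square error bound, uniform in the number of modes and in the time step of the
noise. -/
theorem sum_norm_sq_errVec_le (hd : d = 0 ∨ d = 1) (hT : 0 < T) (hN : 1 ≤ N) (hM : 1 ≤ M) (m : ℕ)
    {ε : ℝ} (hε : 0 < ε) (hε' : ε ≤ 3 / 8) :
    (T / N) * ∑ a ∈ Finset.Icc 1 N ×ˢ Finset.Icc 1 K, ‖(T / N : ℝ)⁻¹ •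
        errVec (discOp d X) (T / N) (T / M) (eig a.2) (epsL2 a.2) m a.1‖ ^ 2
      ≤ 2 * X.size ^ (d + 2) + 4 * (ε⁻¹ * (T / M) ^ (3 / 4 - 2 * ε)) := by
  have hN' : (0 : ℝ) < N := by exact_mod_cast hN
  have hM' : (0 : ℝ) < M := by exact_mod_cast hM
  have hΔ : 0 < T / N := div_pos hT hN'
  have hδ : 0 < T / M := div_pos hT hM'
  set Δ := T / N with hΔdef
  set δ := T / M with hδdef
  have h1 : ∀ i ∈ Finset.Icc 1 K, Δ * ∑ n ∈ Finset.Icc 1 N,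
      ‖Δ⁻¹ • errVec (discOp d X) Δ δ (eig i) (epsL2 i) m n‖ ^ 2
      ≤ 2 * ‖greenOp (epsL2 i - polyProj d X (epsL2 i))‖ ^ 2
        + 8 * (δ ^ (3 / 4 - 2 * ε) * (i : ℝ) ^ (-(1 + 8 * ε))) := fun i hi => by
    have hi1 := (Finset.mem_Icc.mp hi).1
    have h2 := sum_norm_sq_integral_indicator_le hΔ hδ
      (continuous_errKernel (discOp d X) δ (eig i) (epsL2 i) m) N m
    have h3 := sum_integral_norm_sq_errKernel_le (isSymmPos_discOp d X) (eig_pos hi1) hδ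
      (norm_epsL2 hi1) m (a := 3 / 4 - 2 * ε) (by linarith) (by linarith)
    rw [inv_eig_mul_norm_sq_discOp_sub hi1] at h3
    have h4 := eig_mul_rpow_le hi1 hδ hε
    simp_rw [norm_smul, mul_pow, Real.norm_eq_abs, sq_abs]
    rw [← Finset.mul_sum, ← mul_assoc]
    have h5 : Δ * Δ⁻¹ ^ 2 = Δ⁻¹ := by field_simp
    rw [h5, inv_mul_le_iff₀ hΔ]
    refine h2.trans (mul_le_mul_of_nonneg_left (h3.trans ?_) hΔ.le)
    linarith
  rw [Finset.sum_product_right, Finset.mul_sum]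
  refine (Finset.sum_le_sum h1).trans ?_
  rw [Finset.sum_add_distrib, ← Finset.mul_sum, ← Finset.mul_sum, ← Finset.mul_sum]
  have h6 := sum_norm_sq_greenOp_sub_polyProj_le hd X K
  have h7 : ∑ i ∈ Finset.Icc 1 K, (i : ℝ) ^ (-(1 + 8 * ε)) ≤ 1 / 2 * ε⁻¹ := by
    refine (sum_rpow_neg_le (by linarith) K).trans ?_
    have : 1 + 1 / (8 * ε) = (ε + 1 / 8) * ε⁻¹ := by field_simp
    rw [this]
    exact mul_le_mul_of_nonneg_right (by linarith) (by positivity)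
  have h8 := mul_le_mul_of_nonneg_left h7 (show 0 ≤ δ ^ (3 / 4 - 2 * ε) by positivity)
  linarith

/-- The mean square error, by the isometry property of the white noise. -/
theorem IsWhiteNoise.integral_norm_sq_error {Ω : Type*} [MeasurableSpace Ω] {P : Measure Ω}
    {W : Lp ℝ 2 (measTD T) → Ω → ℝ} (hW : IsWhiteNoise T P W)
    (hT : 0 < T) (hM : 1 ≤ M) {u : Ω → ℝ → L2D} {U : Ω → ℕ → L2D}
    (hu : ∀ᵐ ω ∂P, IsSolution T (spectralNoise T K N W ω) (u ω))
    (hU : ∀ᵐ ω ∂P, IsCrankNicolsonFE (d + 2) X T M (spectralNoise T K N W ω) (U ω)) {m : ℕ}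
    (hm : m ≤ M) :
    Integrable (fun ω => ‖U ω m - u ω (m * (T / M))‖ ^ 2) P ∧
      ∫ ω, ‖U ω m - u ω (m * (T / M))‖ ^ 2 ∂P
        = (T / N) * ∑ a ∈ Finset.Icc 1 N ×ˢ Finset.Icc 1 K, ‖(T / N : ℝ)⁻¹ •
          errVec (discOp d X) (T / N) (T / M) (eig a.2) (epsL2 a.2) m a.1‖ ^ 2 := by
  have h := integral_norm_sq_sum (P := P) (S := Finset.Icc 1 N ×ˢ Finset.Icc 1 K)
    (R := fun a : ℕ × ℕ => increment T N W a.1 a.2) (Δ := T / N)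
    (fun a _ => (hW.gaussian.hasGaussianLaw_eval _).memLp_two)
    (fun a ha b hb => by
      obtain ⟨ha1, ha2⟩ := Finset.mem_product.mp ha
      obtain ⟨hb1, hb2⟩ := Finset.mem_product.mp hb
      refine (hW.covar _ _).trans ?_
      split_ifs with hab
      · subst hab
        exact inner_toLp_cell_self hT ha1 (Finset.mem_Icc.mp ha2).1
      · exact inner_toLp_cell_of_ne hT ha1 (Finset.mem_Icc.mp ha2).1 (Finset.mem_Icc.mp hb2).1 hab)
    (fun a => (T / N : ℝ)⁻¹ •
      errVec (discOp d X) (T / N) (T / M) (eig a.2) (epsL2 a.2) m a.1)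
  have hae : (fun ω => ‖∑ a ∈ Finset.Icc 1 N ×ˢ Finset.Icc 1 K, increment T N W a.1 a.2 ω •
      ((T / N : ℝ)⁻¹ • errVec (discOp d X) (T / N) (T / M) (eig a.2) (epsL2 a.2) m a.1)‖ ^ 2)
      =ᵐ[P] fun ω => ‖U ω m - u ω (m * (T / M))‖ ^ 2 := by
    filter_upwards [hu, hU] with ω h1 h2
    rw [error_eq_sum hT hM h1 h2 hm]
  exact ⟨h.1.congr hae, by rw [← integral_congr_ae hae, h.2]⟩

end Main

end

end CrankNicolson

theorem mainTheorem1 (p : ℕ) (hp : p = 2 ∨ p = 3) (T : ℝ) (hT : 0 < T) :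
    ∃ C : ℝ, 0 < C ∧
      ∀ (Ω : Type*) [MeasurableSpace Ω] (P : Measure Ω) [IsProbabilityMeasure P]
        (W : Lp ℝ 2 (CrankNicolson.measTD T) → Ω → ℝ), CrankNicolson.IsWhiteNoise T P W →
      ∀ (K N M : ℕ), 1 ≤ K → 1 ≤ N → 1 ≤ M →
      ∀ (X : CrankNicolson.Mesh)
        (u : Ω → ℝ → CrankNicolson.L2D) (U : Ω → ℕ → CrankNicolson.L2D),
        (∀ᵐ ω ∂P, CrankNicolson.IsSolution T (CrankNicolson.spectralNoise T K N W ω) (u ω)) →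
        (∀ᵐ ω ∂P, CrankNicolson.IsCrankNicolsonFE p X T M
          (CrankNicolson.spectralNoise T K N W ω) (U ω)) →
      ∀ m ≤ M,
        Integrable (fun ω => ‖U ω m - u ω (m * (T / M))‖ ^ 2) P ∧
        ∀ ε₁ ∈ Ioc (0 : ℝ) (p / 2), ∀ ε₂ ∈ Ioc (0 : ℝ) (3 / 8),
          √(∫ ω, ‖U ω m - u ω (m * (T / M))‖ ^ 2 ∂P)
            ≤ C * (ε₁ ^ (-(1 / 2) : ℝ) * X.size ^ ((p : ℝ) / 2 - ε₁)
                + ε₂ ^ (-(1 / 2) : ℝ) * (T / M) ^ (3 / 8 - ε₂)) := by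
  obtain ⟨d, hd, rfl⟩ : ∃ d, (d = 0 ∨ d = 1) ∧ p = d + 2 := by
    rcases hp with rfl | rfl
    exacts [⟨0, by simp⟩, ⟨1, by simp⟩]
  refine ⟨2, two_pos, ?_⟩
  intro Ω _ P _ W hW K N M _ hN hM X u U hu hU m hm
  obtain ⟨hint, heq⟩ := hW.integral_norm_sq_error hT hM hu hU hm
  refine ⟨hint, fun ε₁ hε₁ ε₂ hε₂ => ?_⟩
  rw [heq]
  have hδ : 0 < T / M := div_pos hT (by exact_mod_cast hM)
  have hh := X.size_pos
  have hbound := CrankNicolson.sum_norm_sq_errVec_le (X := X) (K := K) hd hT hN hM m hε₂.1 hε₂.2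
  set α := ε₁ ^ (-(1 / 2) : ℝ) * X.size ^ (((d + 2 : ℕ) : ℝ) / 2 - ε₁) with hα
  set β := ε₂ ^ (-(1 / 2) : ℝ) * (T / M) ^ (3 / 8 - ε₂) with hβ
  have hsq : ∀ x : ℝ, 0 < x → (x ^ (-(1 / 2) : ℝ)) ^ 2 = x⁻¹ := fun x hx => by
    rw [← Real.rpow_natCast, ← Real.rpow_mul hx.le, ← Real.rpow_neg_one]
    norm_num
  have hα0 : 0 ≤ α := mul_nonneg (Real.rpow_nonneg hε₁.1.le _) (Real.rpow_nonneg hh.le _)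
  have hβ0 : 0 ≤ β := mul_nonneg (Real.rpow_nonneg hε₂.1.le _) (Real.rpow_nonneg hδ.le _)
  have hβ2 : β ^ 2 = ε₂⁻¹ * (T / M) ^ (3 / 4 - 2 * ε₂) := by
    rw [hβ, mul_pow, hsq _ hε₂.1, ← Real.rpow_natCast ((T / M) ^ (3 / 8 - ε₂)),
      ← Real.rpow_mul hδ.le]
    congr 2
    push_cast
    ring
  -- for the space error the loss of `ε₁` is not needed: `h ≤ 1` and `ε₁⁻¹ ≥ 1 / 2`
  have hα2 : X.size ^ (d + 2) ≤ 2 * α ^ 2 := by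
    have hε₁2 : ε₁ ≤ 2 := by
      refine hε₁.2.trans ?_
      have : ((d + 2 : ℕ) : ℝ) ≤ 4 := by rcases hd with rfl | rfl <;> norm_num
      linarith
    have h1 : (X.size ^ (((d + 2 : ℕ) : ℝ) / 2 - ε₁)) ^ 2
        = X.size ^ (((d + 2 : ℕ) : ℝ) - 2 * ε₁) := by
      rw [← Real.rpow_natCast, ← Real.rpow_mul hh.le]
      congr 1
      push_cast
      ring
    have h2 : X.size ^ (d + 2) ≤ X.size ^ (((d + 2 : ℕ) : ℝ) - 2 * ε₁) := by
      rw [← Real.rpow_natCast]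
      exact Real.rpow_le_rpow_of_exponent_ge hh X.size_le_one (by linarith [hε₁.1])
    have h3 : 1 ≤ 2 * ε₁⁻¹ := by
      rw [← div_eq_mul_inv, one_le_div hε₁.1]
      exact hε₁2
    rw [hα, mul_pow, hsq _ hε₁.1, h1, ← mul_assoc]
    exact h2.trans (le_mul_of_one_le_left (Real.rpow_nonneg hh.le _) h3)
  refine Real.sqrt_le_iff.mpr ⟨by positivity, hbound.trans ?_⟩
  rw [← hβ2]
  nlinarith [mul_nonneg hα0 hβ0]
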